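/- **Theorem 1.1 (Global existence and bounds).** On $\mathbb R\times\mathbb R^3$ consider the Einstein–scalar–Gauss–Bonnet (ESGB) field equations with free scalar field, unit coupling constant and coupling function $f(\phi)=\tfrac12\phi^2$, $$R_{\mu\nu}-\tfrac12 Rg_{\mu\nu}+\Gamma_{\mu\nu}=2\partial_\mu\phi\,\partial_\nu\phi-(\nabla\phi)^2g_{\mu\nu},\qquad \frac1{\sqrt{-g}}\,\partial_\mu\!\left[\sqrt{-g}\,\partial^\mu\phi\right]-\tfrac14\,\phi\, R_{\rm GB}^2=0,\qquad(\ast)$$ where $R_{\rm GB}^2=R^2-4R_{\mu\nu}R^{\mu\nu}+R_{\mu\nu\rho\sigma}R^{\mu\nu\rho\sigma}$ and, with $f=\tfrac12\phi^2$ and $A_{(\mu\nu)}=\tfrac12(A_{\mu\nu}+A_{\nu\mu})$, $$\Gamma_{\mu\nu}=2R\nabla_\mu\nabla_\nu f+4\left(R_{\mu\nu}-\tfrac12Rg_{\mu\nu}\right)\nabla^\alpha\nabla_\alpha f-8R_{\alpha(\mu}\nabla^\alpha\nabla_{\nu)}f+4R^{\alpha\beta}g_{\mu\nu}\nabla_\alpha\nabla_\beta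 f-4R^\beta{}_{\mu\alpha\nu}\nabla^\alpha\nabla_\beta f .$$ (Conventions: signature $(-,+,+,+)$, $R^\rho{}_{\sigma\mu\nu}=\partial_\mu\Gamma^\rho_{\nu\sigma}-\partial_\nu\Gamma^\rho_{\mu\sigma}+\Gamma^\rho_{\mu\kappa}\Gamma^\kappa_{\nu\sigma}-\Gamma^\rho_{\nu\kappa}\Gamma^\kappa_{\mu\sigma}$, $R_{\mu\nu}=R^\alpha{}_{\mu\alpha\nu}$.) A *global FLRW pair* consists of $g=-dt^2+a(t)^2(dx^2+dy^2+dz^2)$ and $\phi=\phi(t)$ with $a,\phi\in C^2(\mathbb R)$ and $a(t)>0$ for all $t\in\mathbb R$; put $H=\dot a/a$. (0) A global FLRW pair solves $(\ast)$ on all of $\mathbb R\times\mathbb R^3$ if and only if, for all $t\in\mathbb R$, $$3H^2=\dot\phi^2+12H^3\phi\dot\phi,\qquad 2\dot H+3H^2=-\dot\phi^2+8(\dot H+H^2)H\phi\dot\phi+4H^2(\dot\phi^2+\phi\ddot\phi),$$ $$\ddot\phi+3\dot\phi H+6\phi(H^2+\dot H)H^2=0 .$$ Let $a_0>0$ and $\beta\in(0,\tfrac{\sqrt3}3)$.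 Then there is a unique global FLRW pair that solves $(\ast)$ and satisfies $a(0)=a_0$, $H(0)=\beta$, $\phi(0)=0$ and $\dot\phi(0)>0$. In particular this solution is singularity-free in the sense that it is of class $C^2$ with non-degenerate metric for all $t\in(-\infty,+\infty)$. It satisfies the following bounds. 1. *Scalar field.* For $t<0$: $$\frac{\sqrt3}{12}(1-e^{-12t})<\phi(t)<\begin{cases}\frac{\sqrt3}{6\beta^2}(1-e^{-6\beta^3t}),&0<\beta\le\sqrt{5/27},\\ \frac{25\sqrt3}{24}(1-e^{-\frac{48}{125}t}),&\sqrt{5/27}<\beta<\frac{\sqrt3}3.\end{cases}$$ For $t>0$: $$\frac{-1+\sqrt{1+\frac{24\beta^2}5\ln(1+5\beta t)}}{4\sqrt3\,\beta^2}<\phi(t)<\sqrt3\ln(\beta t+1).$$ 2. *Hubble parameter.* For $t<0$: $$\mathfrak L(t)<H(t)<\frac{2\beta+\sqrt2-(\sqrt2-2\beta)e^{3\sqrt2t}}{\sqrt2\left(2\beta+\sqrt2+(\sqrt2-2\beta)e^{3\sqrt2t}\right)},$$ $$\mathfrak L(t)=\begin{cases}\frac{227\beta}{2e^{\frac{454\beta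 t}{45}}+225}>\beta,&0<\beta\le\sqrt{5/27},\\ \frac{2\beta}{5\beta-(5\beta-2)e^{4t}}>\frac25,&\sqrt{5/27}<\beta<\frac{\sqrt3}3.\end{cases}$$ For $t>0$: $$\frac1{5t+\frac1\beta}<H(t)<\frac1{t+\frac1\beta}.$$ 3. *Derivative of the scalar field.* For $t<0$: $$\begin{cases}\sqrt3\,\beta e^{-6\beta^3t},&0<\beta\le\sqrt{5/27}\\ \frac{2\sqrt3}5e^{-\frac{48}{125}t},&\sqrt{5/27}<\beta<\frac{\sqrt3}3\end{cases}\;<\;\dot\phi(t)<\sqrt3\,e^{-12t}.$$ For $t>0$: $$\frac1{\sqrt{1+12\beta^2\ln(\beta t+1)}}\,\frac{\sqrt3}{5t+\frac1\beta}<\dot\phi(t)<\frac{\sqrt3}{t+\frac1\beta}.$$ 4. *Scale factor.* For $t<0$: $$a_0\left(\frac2{(\sqrt2\beta+1)+(1-\sqrt2\beta)e^{3\sqrt2t}}\right)^{\frac13}e^{\frac{\sqrt2}2t}<a(t)<a_0\begin{cases}\left(\frac{227}{225e^{-\frac{454\beta t}{45}}+2}\right)^{\frac1{10}},&0<\beta\le\sqrt{5/27},\\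 \left(\frac2{5\beta e^{-4t}-(5\beta-2)}\right)^{\frac1{10}},&\sqrt{5/27}<\beta<\frac{\sqrt3}3.\end{cases}$$ For $t>0$: $$a_0(5\beta t+1)^{\frac15}<a(t)<a_0(\beta t+1).$$ -/

import Mathlib

namespace ESGB

/-! ### Tensor calculus on `ℝ⁴` in global coordinates `(t, x¹, x², x³)` -/

/-- Points of the spacetime `ℝ × ℝ³`; the coordinate with index `0` is the time `t`. -/
abbrev Point := Fin 4 → ℝ

/-- A metric tensor field, through its components `g_{μν}`. -/
abbrev MetricField := Point → Matrix (Fin 4) (Fin 4) ℝ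

/-- The partial derivative `∂_μ F`. -/
noncomputable def pd (μ : Fin 4) (F : Point → ℝ) (x : Point) : ℝ :=
  deriv (fun s : ℝ => F (Function.update x μ s)) (x μ)

/-- The inverse metric `g^{μν}`. -/
noncomputable def inv (g : MetricField) (μ ν : Fin 4) (x : Point) : ℝ :=
  (g x)⁻¹ μ ν

/-- The Christoffel symbol `Γ^ρ_{μν}` of the Levi-Civita connection. -/
noncomputable def christoffel (g : MetricField) (ρ μ ν : Fin 4) (x : Point) : ℝ :=
  (1 / 2) * ∑ σ, inv g ρ σ x *
    (pd μ (fun y => g y σ ν) x + pd ν (fun y => g y σ μ) x - pd σ (fun y => g y μ ν) x)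

/-- The Riemann tensor
`R^ρ_{σμν} = ∂_μ Γ^ρ_{νσ} - ∂_ν Γ^ρ_{μσ} + Γ^ρ_{μκ} Γ^κ_{νσ} - Γ^ρ_{νκ} Γ^κ_{μσ}`. -/
noncomputable def riemann (g : MetricField) (ρ σ μ ν : Fin 4) (x : Point) : ℝ :=
  pd μ (christoffel g ρ ν σ) x - pd ν (christoffel g ρ μ σ) x
    + ∑ κ, (christoffel g ρ μ κ x * christoffel g κ ν σ x
      - christoffel g ρ ν κ x * christoffel g κ μ σ x)

/-- `R_{ρσμν}`. -/
noncomputable def riemannDown (g : MetricField) (ρ σ μ ν : Fin 4) (x : Point) : ℝ :=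
  ∑ κ, g x ρ κ * riemann g κ σ μ ν x

/-- `R^{ρσμν}`. -/
noncomputable def riemannUp (g : MetricField) (ρ σ μ ν : Fin 4) (x : Point) : ℝ :=
  ∑ α, ∑ β, ∑ γ, inv g σ α x * inv g μ β x * inv g ν γ x * riemann g ρ α β γ x

/-- The Ricci tensor `R_{μν} = R^α_{μαν}`. -/
noncomputable def ricci (g : MetricField) (μ ν : Fin 4) (x : Point) : ℝ :=
  ∑ α, riemann g α μ α ν x

/-- `R^{μν}`. -/
noncomputable def ricciUp (g : MetricField) (μ ν : Fin 4) (x : Point) : ℝ :=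
  ∑ α, ∑ β, inv g μ α x * inv g ν β x * ricci g α β x

/-- The scalar curvature `R = g^{μν} R_{μν}`. -/
noncomputable def scalarCurvature (g : MetricField) (x : Point) : ℝ :=
  ∑ μ, ∑ ν, inv g μ ν x * ricci g μ ν x

/-- The Einstein tensor `R_{μν} - (1/2) R g_{μν}`. -/
noncomputable def einstein (g : MetricField) (μ ν : Fin 4) (x : Point) : ℝ :=
  ricci g μ ν x - (1 / 2) * scalarCurvature g x * g x μ ν

/-- The Gauss–Bonnet term
`R_GB² = R² - 4 R_{μν} R^{μν} + R_{μνρσ} R^{μνρσ}`. -/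
noncomputable def gaussBonnet (g : MetricField) (x : Point) : ℝ :=
  scalarCurvature g x ^ 2 - 4 * (∑ μ, ∑ ν, ricci g μ ν x * ricciUp g μ ν x)
    + ∑ μ, ∑ ν, ∑ ρ, ∑ σ, riemannDown g μ ν ρ σ x * riemannUp g μ ν ρ σ x

/-- The covariant Hessian `∇_μ ∇_ν F`. -/
noncomputable def hess (g : MetricField) (F : Point → ℝ) (μ ν : Fin 4) (x : Point) : ℝ :=
  pd μ (pd ν F) x - ∑ κ, christoffel g κ μ ν x * pd κ F x

/-- `∇^μ ∇_ν F`. -/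
noncomputable def hessMixed (g : MetricField) (F : Point → ℝ) (μ ν : Fin 4) (x : Point) : ℝ :=
  ∑ κ, inv g μ κ x * hess g F κ ν x

/-! ### The Einstein–scalar–Gauss–Bonnet field equations -/

/-- The coupling function `f(φ) = φ² / 2` as a function on spacetime. -/
noncomputable def coupling (φ : Point → ℝ) (x : Point) : ℝ :=
  (1 / 2) * φ x ^ 2

/-- The tensor `Γ_{μν}` through which the Gauss–Bonnet coupling enters, where `f = φ² / 2`:
`2 R ∇_μ∇_ν f + 4 (R_{μν} - R g_{μν} / 2) ∇^α∇_α f - 8 R_{α(μ} ∇^α∇_{ν)} f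
  + 4 R^{αβ} g_{μν} ∇_α∇_β f - 4 R^β_{μαν} ∇^α∇_β f`.
Round brackets around indices denote symmetrization with the factor `1/2`. -/
noncomputable def couplingTensor (g : MetricField) (φ : Point → ℝ) (μ ν : Fin 4)
    (x : Point) : ℝ :=
  2 * scalarCurvature g x * hess g (coupling φ) μ ν x
    + 4 * einstein g μ ν x * (∑ α, hessMixed g (coupling φ) α α x)
    - 8 * (∑ α, (1 / 2) * (ricci g α μ x * hessMixed g (coupling φ) α ν x
        + ricci g α ν x * hessMixed g (coupling φ) α μ x))
    + 4 * (∑ α, ∑ β, ricciUp g α β x * g x μ ν * hess g (coupling φ) α β x)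
    - 4 * (∑ α, ∑ β, riemann g β μ α ν x * hessMixed g (coupling φ) α β x)

/-- `(∇φ)² = g^{αβ} ∂_α φ ∂_β φ`. -/
noncomputable def gradSq (g : MetricField) (φ : Point → ℝ) (x : Point) : ℝ :=
  ∑ α, ∑ β, inv g α β x * pd α φ x * pd β φ x

/-- `√(-det g)`. -/
noncomputable def volDensity (g : MetricField) (x : Point) : ℝ :=
  Real.sqrt (-(g x).det)

/-- The ESGB field equations with free scalar field, unit coupling constant and quadratic
coupling function, at every point of `ℝ⁴`. -/
structure FieldEquations (g : MetricField) (φ : Point → ℝ) : Prop where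
  tensor_eq : ∀ (x : Point) (μ ν : Fin 4),
    einstein g μ ν x + couplingTensor g φ μ ν x
      = 2 * pd μ φ x * pd ν φ x - gradSq g φ x * g x μ ν
  scalar_eq : ∀ x : Point,
    1 / volDensity g x *
        (∑ μ, pd μ (fun y => volDensity g y * ∑ ν, inv g μ ν y * pd ν φ y) x)
      - (1 / 4) * φ x * gaussBonnet g x = 0

/-! ### FLRW spacetimes -/

/-- The spatially flat FLRW metric `-dt² + a(t)² (dx² + dy² + dz²)` on `ℝ × ℝ³`. -/
noncomputable def flrw (a : ℝ → ℝ) : MetricField := fun x =>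
  Matrix.diagonal ![-1, a (x 0) ^ 2, a (x 0) ^ 2, a (x 0) ^ 2]

/-- The Hubble parameter `H = ȧ / a`. -/
noncomputable def hubble (a : ℝ → ℝ) (t : ℝ) : ℝ :=
  deriv a t / a t

/-- A pair `(a, φ)` describing a homogeneous and isotropic pair `(g, φ)` of class `C²` for all
times `t ∈ ℝ`, with a non-degenerate metric at all times. -/
structure IsFLRW (a φ : ℝ → ℝ) : Prop where
  scale_C2 : ContDiff ℝ 2 a
  scalar_C2 : ContDiff ℝ 2 φ
  scale_pos : ∀ t, 0 < a t

/-- The field equations reduced to ordinary differential equations for `H = ȧ / a` and `φ`. -/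
structure ReducedSystem (a φ : ℝ → ℝ) : Prop where
  friedmann : ∀ t, 3 * hubble a t ^ 2
    = deriv φ t ^ 2 + 12 * hubble a t ^ 3 * φ t * deriv φ t
  evolution : ∀ t, 2 * deriv (hubble a) t + 3 * hubble a t ^ 2
    = -deriv φ t ^ 2
      + 8 * (deriv (hubble a) t + hubble a t ^ 2) * hubble a t * φ t * deriv φ t
      + 4 * hubble a t ^ 2 * (deriv φ t ^ 2 + φ t * deriv (deriv φ) t)
  scalar : ∀ t, deriv (deriv φ) t + 3 * deriv φ t * hubble a t
    + 6 * φ t * (hubble a t ^ 2 + deriv (hubble a) t) * hubble a t ^ 2 = 0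

/-- `(a, φ)` describes a global FLRW solution of the ESGB field equations with
`a(0) = a₀`, `H(0) = β`, `φ(0) = 0` and `φ̇(0) > 0`. -/
structure IsGlobalSolution (a₀ β : ℝ) (a φ : ℝ → ℝ) : Prop where
  isFLRW : IsFLRW a φ
  field_eq : FieldEquations (flrw a) (fun x => φ (x 0))
  scale_init : a 0 = a₀
  hubble_init : hubble a 0 = β
  scalar_init : φ 0 = 0
  scalar_deriv_init : 0 < deriv φ 0

/-! ### The functions in the bounds for `t < 0` -/

/-- Upper bound for `φ`. -/
noncomputable def boundPhi (β t : ℝ) : ℝ :=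
  if β ≤ Real.sqrt (5 / 27) then
    Real.sqrt 3 / (6 * β ^ 2) * (1 - Real.exp (-6 * β ^ 3 * t))
  else
    25 * Real.sqrt 3 / 24 * (1 - Real.exp (-(48 / 125) * t))

/-- Lower bound for `H`. -/
noncomputable def boundH (β t : ℝ) : ℝ :=
  if β ≤ Real.sqrt (5 / 27) then
    227 * β / (2 * Real.exp (454 * β * t / 45) + 225)
  else
    2 * β / (5 * β - (5 * β - 2) * Real.exp (4 * t))

/-- Lower bound for `φ̇`. -/
noncomputable def boundPhiDot (β t : ℝ) : ℝ :=
  if β ≤ Real.sqrt (5 / 27) then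
    Real.sqrt 3 * β * Real.exp (-6 * β ^ 3 * t)
  else
    2 * Real.sqrt 3 / 5 * Real.exp (-(48 / 125) * t)

/-- Upper bound for `a / a₀`. -/
noncomputable def boundScale (β t : ℝ) : ℝ :=
  if β ≤ Real.sqrt (5 / 27) then
    (227 / (225 * Real.exp (-(454 * β * t / 45)) + 2)) ^ (1 / 10 : ℝ)
  else
    (2 / (5 * β * Real.exp (-4 * t) - (5 * β - 2))) ^ (1 / 10 : ℝ)

/-- The bounds in the past. -/
structure PastBounds (a₀ β : ℝ) (a φ : ℝ → ℝ) (t : ℝ) : Prop where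
  scalar_lower : Real.sqrt 3 / 12 * (1 - Real.exp (-12 * t)) < φ t
  scalar_upper : φ t < boundPhi β t
  hubble_lower : boundH β t < hubble a t
  hubble_upper : hubble a t <
    (2 * β + Real.sqrt 2 - (Real.sqrt 2 - 2 * β) * Real.exp (3 * Real.sqrt 2 * t)) /
      (Real.sqrt 2 *
        (2 * β + Real.sqrt 2 + (Real.sqrt 2 - 2 * β) * Real.exp (3 * Real.sqrt 2 * t)))
  boundH_small : β ≤ Real.sqrt (5 / 27) → β < boundH β t
  boundH_large : Real.sqrt (5 / 27) < β → 2 / 5 < boundH β t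
  deriv_lower : boundPhiDot β t < deriv φ t
  deriv_upper : deriv φ t < Real.sqrt 3 * Real.exp (-12 * t)
  scale_lower :
    a₀ * (2 / ((Real.sqrt 2 * β + 1)
        + (1 - Real.sqrt 2 * β) * Real.exp (3 * Real.sqrt 2 * t))) ^ (1 / 3 : ℝ)
      * Real.exp (Real.sqrt 2 / 2 * t) < a t
  scale_upper : a t < a₀ * boundScale β t

/-- The bounds in the future. -/
structure FutureBounds (a₀ β : ℝ) (a φ : ℝ → ℝ) (t : ℝ) : Prop where
  scalar_lower :
    (-1 + Real.sqrt (1 + 24 * β ^ 2 / 5 * Real.log (1 + 5 * β * t)))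
      / (4 * Real.sqrt 3 * β ^ 2) < φ t
  scalar_upper : φ t < Real.sqrt 3 * Real.log (β * t + 1)
  hubble_lower : 1 / (5 * t + 1 / β) < hubble a t
  hubble_upper : hubble a t < 1 / (t + 1 / β)
  deriv_lower :
    1 / Real.sqrt (1 + 12 * β ^ 2 * Real.log (β * t + 1))
      * (Real.sqrt 3 / (5 * t + 1 / β)) < deriv φ t
  deriv_upper : deriv φ t < Real.sqrt 3 / (t + 1 / β)
  scale_lower : a₀ * (5 * β * t + 1) ^ (1 / 5 : ℝ) < a t
  scale_upper : a t < a₀ * (β * t + 1)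

end ESGB

namespace ESGB

/-! ### Curvature of the FLRW metric -/

/-! For an FLRW pair all curvature components are explicit in `a`, `ȧ`, `ä`. Isotropy leaves one
time-time, one space-space and one scalar equation, which form the reduced system
(`fieldEquations_iff_reducedSystem`).

The key variable is `q = φ̇² / (3H²)`. The Friedmann constraint becomes `4Hφφ̇ = 1 - q`, so `φ` and
`φ̇` are algebraic functions of `H` and `q`. The other two equations are linear in `Ḣ` and `φ̈`.
Solving them gives an autonomous planar system for `(H, q)` with field `(speedH, speedQ)`, whose
denominator `1 - 2q + 5q²` never vanishes. The initial data become `H = β`, `q = 1`. The translation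
works in both directions: `IsFlow.isGlobalSolution` and `IsGlobalSolution.exists_isFlow`.

Everything else is comparison on the line. Since `q` decreases through the value `1`, `q > 1` in the
past and `q < 1` in the future. Under these signs `speedH` lies between simple functions of `H`
alone. The explicit bounds for `H` solve the resulting scalar Riccati or logistic equations and act
as barriers: at a contact the difference crosses zero in one direction only
(`neg_of_deriv_neg_of_zero`, `pos_of_deriv_neg_of_zero`). The bounds for `a` follow by integrating
`H = (log a)˙`. Those for `φ̇` in the past follow by integrating its logarithmic derivative
`scalarRate`, and in the future from bounds on `H` and `q`. Most bounds for `φ` then come by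
integrating `φ̇`.

For global existence, `θ = q / (1 + q)` compactifies the phase space to `[0,1]²`. The field
precomposed with the projection to this square is bounded and globally Lipschitz, hence complete.
The lines `H = 0`, `θ = 0`, `θ = 1` cannot be reached, and the barriers keep `H < 1`, so the
projection never acts. The same Lipschitz field gives uniqueness. -/

theorem pd_comp_time (μ : Fin 4) (f : ℝ → ℝ) (x : Point) :
    pd μ (fun y => f (y 0)) x = if μ = 0 then deriv f (x 0) else 0 := by
  unfold pd
  split_ifs with h
  · subst h; simp
  · have : ∀ s, Function.update x μ s 0 = x 0 := fun s =>
      Function.update_of_ne (Ne.symm h) _ _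
    simp [this]

theorem inv_flrw {a : ℝ → ℝ} (ha : ∀ t, 0 < a t) (μ ν : Fin 4) (x : Point) :
    inv (flrw a) μ ν x
      = if μ = ν then (if μ = 0 then -1 else (a (x 0) ^ 2)⁻¹) else 0 := by
  have h : (flrw a x)⁻¹ = Matrix.diagonal (fun i : Fin 4 => if i = 0 then -1 else (a (x 0) ^ 2)⁻¹) := by
    apply Matrix.inv_eq_left_inv
    have := (ha (x 0)).ne'
    rw [flrw, Matrix.diagonal_mul_diagonal, ← Matrix.diagonal_one]
    congr 1
    ext i
    fin_cases i <;> simp [this]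
  rw [inv, h, Matrix.diagonal_apply]

theorem flrw_apply (a : ℝ → ℝ) (μ ν : Fin 4) (x : Point) :
    flrw a x μ ν = if μ = ν then (if μ = 0 then -1 else a (x 0) ^ 2) else 0 := by
  rw [flrw, Matrix.diagonal_apply]
  fin_cases μ <;> simp

theorem pd_flrw {a : ℝ → ℝ} (ha : ContDiff ℝ 2 a) (ρ μ ν : Fin 4) (x : Point) :
    pd ρ (fun y => flrw a y μ ν) x
      = if ρ = 0 ∧ μ = ν ∧ μ ≠ 0 then 2 * a (x 0) * deriv a (x 0) else 0 := by
  have hd : deriv (fun t => a t ^ 2) (x 0) = 2 * a (x 0) * deriv a (x 0) := by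
    have := ((ha.differentiable (by norm_num)) (x 0)).hasDerivAt.fun_pow 2
    simpa using this.deriv
  simp only [flrw_apply]
  by_cases h1 : μ = ν
  · by_cases h2 : μ = 0
    · simp only [h1 ▸ h2, h1, if_true]
      rw [pd_comp_time ρ (fun _ => -1)]; simp
    · simp only [h1 ▸ h2, h1, if_true, if_false]
      rw [pd_comp_time ρ (fun t => a t ^ 2), hd]; simp [h1 ▸ h2]
  · simp only [h1, if_false]
    rw [pd_comp_time ρ (fun _ => 0)]; simp

/-- The Christoffel symbols of the FLRW metric as functions of time. -/
noncomputable def flrwChristoffel (a : ℝ → ℝ) (ρ μ ν : Fin 4) (t : ℝ) : ℝ :=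
  if ρ = 0 then (if μ = ν ∧ μ ≠ 0 then a t * deriv a t else 0)
  else if (μ = 0 ∧ ν = ρ) ∨ (ν = 0 ∧ μ = ρ) then deriv a t / a t else 0

theorem christoffel_flrw {a : ℝ → ℝ} (hC : ContDiff ℝ 2 a) (ha : ∀ t, 0 < a t)
    (ρ μ ν : Fin 4) :
    christoffel (flrw a) ρ μ ν = fun x => flrwChristoffel a ρ μ ν (x 0) := by
  ext x
  have h0 := (ha (x 0)).ne'
  simp only [christoffel, inv_flrw ha, pd_flrw hC, flrwChristoffel, ite_mul, zero_mul,
    Finset.sum_ite_eq, Finset.mem_univ, if_true]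
  fin_cases ρ <;> fin_cases μ <;> fin_cases ν <;> simp <;> field_simp

/-- The derivatives of the Christoffel symbols of the FLRW metric. -/
noncomputable def flrwChristoffelDeriv (a : ℝ → ℝ) (ρ μ ν : Fin 4) (t : ℝ) : ℝ :=
  if ρ = 0 then
    (if μ = ν ∧ μ ≠ 0 then deriv a t ^ 2 + a t * deriv (deriv a) t else 0)
  else if (μ = 0 ∧ ν = ρ) ∨ (ν = 0 ∧ μ = ρ) then
    deriv (deriv a) t / a t - (deriv a t / a t) ^ 2 else 0

theorem hasDerivAt_deriv {f : ℝ → ℝ} (hf : ContDiff ℝ 2 f) (t : ℝ) :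
    HasDerivAt (deriv f) (deriv (deriv f) t) t := by
  have : ContDiff ℝ 1 (deriv f) := by
    have h2 : ContDiff ℝ (1 + 1) f := by simpa [one_add_one_eq_two] using hf
    exact (contDiff_succ_iff_deriv.1 h2).2.2
  exact (this.differentiable (by norm_num) t).hasDerivAt

theorem hasDerivAt_of_C2 {f : ℝ → ℝ} (hf : ContDiff ℝ 2 f) (t : ℝ) :
    HasDerivAt f (deriv f t) t :=
  (hf.differentiable (by norm_num) t).hasDerivAt

theorem deriv_flrwChristoffel {a : ℝ → ℝ} (hC : ContDiff ℝ 2 a) (ha : ∀ t, 0 < a t)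
    (ρ μ ν : Fin 4) (t : ℝ) :
    deriv (flrwChristoffel a ρ μ ν) t = flrwChristoffelDeriv a ρ μ ν t := by
  have h0 := (ha t).ne'
  have h1 := hasDerivAt_of_C2 hC t
  have h2 := hasDerivAt_deriv hC t
  unfold flrwChristoffel flrwChristoffelDeriv
  split_ifs
  · rw [(h1.fun_mul h2).deriv]; ring
  · simp
  · rw [(h2.fun_div h1 h0).deriv]; field_simp
  · simp

/-- The Riemann tensor of the FLRW metric as a function of time. -/
noncomputable def flrwRiemann (a : ℝ → ℝ) (ρ σ μ ν : Fin 4) (t : ℝ) : ℝ :=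
  if ρ = 0 then
    if σ = 0 then 0 else
      (if μ = 0 ∧ ν = σ then a t * deriv (deriv a) t else 0)
        - (if ν = 0 ∧ μ = σ then a t * deriv (deriv a) t else 0)
  else if σ = 0 then
    (if μ = 0 ∧ ν = ρ then deriv (deriv a) t / a t else 0)
      - (if ν = 0 ∧ μ = ρ then deriv (deriv a) t / a t else 0)
  else (if μ = ρ ∧ ν = σ then deriv a t ^ 2 else 0)
    - (if ν = ρ ∧ μ = σ then deriv a t ^ 2 else 0)

theorem riemann_flrw {a : ℝ → ℝ} (hC : ContDiff ℝ 2 a) (ha : ∀ t, 0 < a t)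
    (ρ σ μ ν : Fin 4) (x : Point) :
    riemann (flrw a) ρ σ μ ν x = flrwRiemann a ρ σ μ ν (x 0) := by
  have h0 := (ha (x 0)).ne'
  simp only [riemann, christoffel_flrw hC ha, pd_comp_time, deriv_flrwChristoffel hC ha,
    Fin.sum_univ_four]
  generalize x 0 = t at *
  fin_cases ρ <;> fin_cases σ <;> fin_cases μ <;> fin_cases ν <;>
    simp [flrwChristoffel, flrwChristoffelDeriv, flrwRiemann] <;> field_simp <;> ring

theorem ricci_flrw {a : ℝ → ℝ} (hC : ContDiff ℝ 2 a) (ha : ∀ t, 0 < a t)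
    (μ ν : Fin 4) (x : Point) :
    ricci (flrw a) μ ν x =
      if μ = ν then (if μ = 0 then -3 * (deriv (deriv a) (x 0) / a (x 0))
        else a (x 0) * deriv (deriv a) (x 0) + 2 * deriv a (x 0) ^ 2) else 0 := by
  simp only [ricci, riemann_flrw hC ha, Fin.sum_univ_four]
  generalize x 0 = t at *
  fin_cases μ <;> fin_cases ν <;> simp [flrwRiemann] <;> ring

theorem ricciUp_flrw {a : ℝ → ℝ} (hC : ContDiff ℝ 2 a) (ha : ∀ t, 0 < a t)
    (μ ν : Fin 4) (x : Point) :
    ricciUp (flrw a) μ ν x =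
      if μ = ν then (if μ = 0 then -3 * (deriv (deriv a) (x 0) / a (x 0))
        else (a (x 0) * deriv (deriv a) (x 0) + 2 * deriv a (x 0) ^ 2) / a (x 0) ^ 4)
      else 0 := by
  have h0 := (ha (x 0)).ne'
  simp only [ricciUp, inv_flrw ha, ricci_flrw hC ha]
  rw [Finset.sum_eq_single μ, Finset.sum_eq_single ν]
  · generalize x 0 = t at *
    fin_cases μ <;> fin_cases ν <;> simp <;> field_simp
  all_goals first
    | (intro b _ hb; simp [hb.symm])
    | simp

theorem scalarCurvature_flrw {a : ℝ → ℝ} (hC : ContDiff ℝ 2 a) (ha : ∀ t, 0 < a t)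
    (x : Point) :
    scalarCurvature (flrw a) x =
      6 * (deriv (deriv a) (x 0) / a (x 0) + (deriv a (x 0) / a (x 0)) ^ 2) := by
  have h0 := (ha (x 0)).ne'
  simp only [scalarCurvature, inv_flrw ha, ricci_flrw hC ha, ite_mul, zero_mul,
    Finset.sum_ite_eq, Finset.mem_univ, if_true, Fin.sum_univ_four]
  simp
  field_simp
  ring

theorem riemannUp_flrw {a : ℝ → ℝ} (hC : ContDiff ℝ 2 a) (ha : ∀ t, 0 < a t)
    (ρ σ μ ν : Fin 4) (x : Point) :
    riemannUp (flrw a) ρ σ μ ν x =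
      (if σ = 0 then -1 else (a (x 0) ^ 2)⁻¹) * (if μ = 0 then -1 else (a (x 0) ^ 2)⁻¹)
        * (if ν = 0 then -1 else (a (x 0) ^ 2)⁻¹) * flrwRiemann a ρ σ μ ν (x 0) := by
  simp only [riemannUp, inv_flrw ha, riemann_flrw hC ha]
  rw [Finset.sum_eq_single σ, Finset.sum_eq_single μ, Finset.sum_eq_single ν]
  · simp
  all_goals first
    | (intro b _ hb; simp [hb.symm])
    | simp

theorem riemannDown_flrw {a : ℝ → ℝ} (hC : ContDiff ℝ 2 a) (ha : ∀ t, 0 < a t)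
    (ρ σ μ ν : Fin 4) (x : Point) :
    riemannDown (flrw a) ρ σ μ ν x =
      (if ρ = 0 then -1 else a (x 0) ^ 2) * flrwRiemann a ρ σ μ ν (x 0) := by
  simp only [riemannDown, flrw_apply, riemann_flrw hC ha, ite_mul, zero_mul,
    Finset.sum_ite_eq, Finset.mem_univ, if_true]

theorem gaussBonnet_flrw {a : ℝ → ℝ} (hC : ContDiff ℝ 2 a) (ha : ∀ t, 0 < a t)
    (x : Point) :
    gaussBonnet (flrw a) x =
      24 * (deriv (deriv a) (x 0) / a (x 0)) * (deriv a (x 0) / a (x 0)) ^ 2 := by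
  have h0 := (ha (x 0)).ne'
  simp only [gaussBonnet, scalarCurvature_flrw hC ha, ricci_flrw hC ha, ricciUp_flrw hC ha,
    riemannDown_flrw hC ha, riemannUp_flrw hC ha]
  generalize x 0 = t at *
  simp only [Fin.sum_univ_four]
  simp [flrwRiemann]
  field_simp
  ring

/-! ### The field equations of an FLRW pair -/

section FLRW

variable {a φ : ℝ → ℝ}

theorem pd_coupling (hφ : ContDiff ℝ 2 φ) (μ : Fin 4) :
    pd μ (coupling (fun y => φ (y 0))) =
      fun x => (fun t => if μ = 0 then φ t * deriv φ t else 0) (x 0) := by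
  ext x
  have h : deriv (fun t => 1 / 2 * φ t ^ 2) (x 0) = φ (x 0) * deriv φ (x 0) := by
    rw [(((hasDerivAt_of_C2 hφ (x 0)).fun_pow 2).const_mul (1 / 2)).deriv]
    ring
  have := pd_comp_time μ (fun t => 1 / 2 * φ t ^ 2) x
  rw [h] at this
  exact this

theorem pd_pd_coupling (hφ : ContDiff ℝ 2 φ) (μ ν : Fin 4) (x : Point) :
    pd μ (pd ν (coupling (fun y => φ (y 0)))) x =
      if μ = 0 ∧ ν = 0 then deriv φ (x 0) ^ 2 + φ (x 0) * deriv (deriv φ) (x 0) else 0 := by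
  rw [pd_coupling hφ]
  refine (pd_comp_time μ (fun t => if ν = 0 then φ t * deriv φ t else 0) x).trans ?_
  by_cases hν : ν = 0
  · simp only [hν, if_true, and_true]
    rw [((hasDerivAt_of_C2 hφ (x 0)).fun_mul (hasDerivAt_deriv hφ (x 0))).deriv, sq]
  · simp [hν]

theorem hess_coupling (hC : ContDiff ℝ 2 a) (ha : ∀ t, 0 < a t) (hφ : ContDiff ℝ 2 φ)
    (μ ν : Fin 4) (x : Point) :
    hess (flrw a) (coupling (fun y => φ (y 0))) μ ν x =
      if μ = ν then (if μ = 0 then deriv φ (x 0) ^ 2 + φ (x 0) * deriv (deriv φ) (x 0)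
        else -(a (x 0) * deriv a (x 0)) * (φ (x 0) * deriv φ (x 0))) else 0 := by
  simp only [hess, pd_pd_coupling hφ]
  simp only [pd_coupling hφ, christoffel_flrw hC ha, Fin.sum_univ_four]
  generalize x 0 = t at *
  fin_cases μ <;> fin_cases ν <;> simp [flrwChristoffel]

theorem hessMixed_coupling (hC : ContDiff ℝ 2 a) (ha : ∀ t, 0 < a t) (hφ : ContDiff ℝ 2 φ)
    (μ ν : Fin 4) (x : Point) :
    hessMixed (flrw a) (coupling (fun y => φ (y 0))) μ ν x =
      if μ = ν then
        (if μ = 0 then -(deriv φ (x 0) ^ 2 + φ (x 0) * deriv (deriv φ) (x 0))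
          else -(deriv a (x 0) / a (x 0)) * (φ (x 0) * deriv φ (x 0))) else 0 := by
  have h0 := (ha (x 0)).ne'
  simp only [hessMixed, inv_flrw ha, hess_coupling hC ha hφ, ite_mul, zero_mul,
    Finset.sum_ite_eq, Finset.mem_univ, if_true]
  split_ifs <;> field_simp <;> simp

theorem einstein_flrw (hC : ContDiff ℝ 2 a) (ha : ∀ t, 0 < a t) (μ ν : Fin 4) (x : Point) :
    einstein (flrw a) μ ν x =
      if μ = ν then (if μ = 0 then 3 * (deriv a (x 0) / a (x 0)) ^ 2
        else -(2 * a (x 0) * deriv (deriv a) (x 0) + deriv a (x 0) ^ 2)) else 0 := by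
  have h0 := (ha (x 0)).ne'
  simp only [einstein, ricci_flrw hC ha, scalarCurvature_flrw hC ha, flrw_apply]
  split_ifs
  · field_simp; ring
  · field_simp; ring
  · ring

theorem couplingTensor_flrw (hC : ContDiff ℝ 2 a) (ha : ∀ t, 0 < a t) (hφ : ContDiff ℝ 2 φ)
    (μ ν : Fin 4) (x : Point) :
    couplingTensor (flrw a) (fun y => φ (y 0)) μ ν x =
      if μ = ν then
        (if μ = 0 then -12 * (deriv a (x 0) / a (x 0)) ^ 3 * (φ (x 0) * deriv φ (x 0))
          else a (x 0) ^ 2 * (8 * (deriv (deriv a) (x 0) / a (x 0)) *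
              (deriv a (x 0) / a (x 0)) * (φ (x 0) * deriv φ (x 0))
            + 4 * (deriv a (x 0) / a (x 0)) ^ 2 *
              (deriv φ (x 0) ^ 2 + φ (x 0) * deriv (deriv φ) (x 0)))) else 0 := by
  have h0 := (ha (x 0)).ne'
  simp only [couplingTensor, hess_coupling hC ha hφ, hessMixed_coupling hC ha hφ,
    einstein_flrw hC ha, ricci_flrw hC ha, ricciUp_flrw hC ha, scalarCurvature_flrw hC ha,
    flrw_apply, riemann_flrw hC ha]
  generalize x 0 = t at *
  simp only [Fin.sum_univ_four]
  fin_cases μ <;> fin_cases ν <;> simp [flrwRiemann] <;> field_simp <;> ring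

theorem gradSq_flrw (ha : ∀ t, 0 < a t) (x : Point) :
    gradSq (flrw a) (fun y => φ (y 0)) x = -deriv φ (x 0) ^ 2 := by
  simp only [gradSq, inv_flrw ha, pd_comp_time, Fin.sum_univ_four]
  simp
  ring

theorem volDensity_flrw (ha : ∀ t, 0 < a t) (x : Point) :
    volDensity (flrw a) x = a (x 0) ^ 3 := by
  rw [volDensity, flrw, Matrix.det_diagonal, Fin.prod_univ_four]
  rw [← Real.sqrt_sq (pow_pos (ha (x 0)) 3).le]
  congr 1
  simp
  ring

theorem wave_flrw (hC : ContDiff ℝ 2 a) (ha : ∀ t, 0 < a t) (hφ : ContDiff ℝ 2 φ)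
    (x : Point) :
    1 / volDensity (flrw a) x *
        (∑ μ, pd μ (fun y => volDensity (flrw a) y *
          ∑ ν, inv (flrw a) μ ν y * pd ν (fun y => φ (y 0)) y) x) =
      -(deriv (deriv φ) (x 0) + 3 * (deriv a (x 0) / a (x 0)) * deriv φ (x 0)) := by
  have h0 := (ha (x 0)).ne'
  have hμ : ∀ μ : Fin 4, (fun y : Point => volDensity (flrw a) y *
      ∑ ν, inv (flrw a) μ ν y * pd ν (fun y => φ (y 0)) y)
      = fun y => (fun t => if μ = 0 then -(a t ^ 3 * deriv φ t) else 0) (y 0) := by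
    intro μ
    ext y
    simp only [volDensity_flrw ha, inv_flrw ha, pd_comp_time, ite_mul, zero_mul,
      Finset.sum_ite_eq, Finset.mem_univ, if_true]
    split_ifs <;> simp
  have hd : deriv (fun t => -(a t ^ 3 * deriv φ t)) (x 0) =
      -(3 * a (x 0) ^ 2 * deriv a (x 0) * deriv φ (x 0)
        + a (x 0) ^ 3 * deriv (deriv φ) (x 0)) := by
    rw [((((hasDerivAt_of_C2 hC (x 0)).fun_pow 3).fun_mul
      (hasDerivAt_deriv hφ (x 0))).fun_neg).deriv]
    norm_num
  have hpd : ∀ μ : Fin 4, pd μ (fun y => (fun t => if μ = 0 then -(a t ^ 3 * deriv φ t)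
      else 0) (y 0)) x = if μ = 0 then deriv (fun t => -(a t ^ 3 * deriv φ t)) (x 0) else 0 := by
    intro μ
    rw [pd_comp_time μ (fun t => if μ = 0 then -(a t ^ 3 * deriv φ t) else 0)]
    by_cases h : μ = 0 <;> simp [h]
  simp only [hμ, hpd]
  simp only [volDensity_flrw ha, Finset.sum_ite_eq', Finset.mem_univ, if_true, hd]
  field_simp
  ring

theorem hasDerivAt_hubble (hC : ContDiff ℝ 2 a) (ha : ∀ t, 0 < a t) (t : ℝ) :
    HasDerivAt (hubble a) (deriv (deriv a) t / a t - hubble a t ^ 2) t := by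
  have h0 := (ha t).ne'
  have h := (hasDerivAt_deriv hC t).fun_div (hasDerivAt_of_C2 hC t) h0
  have e : deriv (deriv a) t / a t - hubble a t ^ 2 =
      (deriv (deriv a) t * a t - deriv a t * deriv a t) / a t ^ 2 := by
    simp only [hubble]
    field_simp
  rw [e]
  exact h

/-- All tensors involved are diagonal and their spatial entries coincide, so the components `00` and
`11` carry the whole tensor equation. The `11` component is `a²` times the evolution equation. The
scalar equation uses `R_GB² = 24 (ä/a) H²` and `ä/a = Ḣ + H²`. -/
theorem fieldEquations_iff_reducedSystem (h : IsFLRW a φ) :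
    FieldEquations (flrw a) (fun x => φ (x 0)) ↔ ReducedSystem a φ := by
  obtain ⟨hC, hφ, ha⟩ := h
  have hH : ∀ t, deriv (hubble a) t = deriv (deriv a) t / a t - hubble a t ^ 2 :=
    fun t => (hasDerivAt_hubble hC ha t).deriv
  constructor
  · rintro ⟨ht, hs⟩
    refine ⟨fun t => ?_, fun t => ?_, fun t => ?_⟩
    · have := ht (fun _ => t) 0 0
      simp only [einstein_flrw hC ha, couplingTensor_flrw hC ha hφ, pd_comp_time,
        gradSq_flrw ha, flrw_apply, if_true] at this
      simp only [hubble]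
      linarith
    · have := ht (fun _ => t) 1 1
      have h0 := ha t
      simp only [einstein_flrw hC ha, couplingTensor_flrw hC ha hφ, pd_comp_time,
        gradSq_flrw ha, flrw_apply, if_true, one_ne_zero, if_false] at this
      rw [hH]
      simp only [hubble]
      refine mul_left_cancel₀ (pow_pos h0 2).ne' ?_
      have e : a t ^ 2 * (2 * (deriv (deriv a) t / a t - (deriv a t / a t) ^ 2)
          + 3 * (deriv a t / a t) ^ 2) = 2 * a t * deriv (deriv a) t + deriv a t ^ 2 := by
        field_simp; ring
      rw [e]
      linarith
    · have := hs (fun _ => t)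
      rw [wave_flrw hC ha hφ, gaussBonnet_flrw hC ha] at this
      rw [hH]
      simp only [hubble]
      linarith
  · rintro ⟨h1, h2, h3⟩
    refine ⟨fun x μ ν => ?_, fun x => ?_⟩
    · simp only [einstein_flrw hC ha, couplingTensor_flrw hC ha hφ, pd_comp_time,
        gradSq_flrw ha, flrw_apply]
      by_cases hμν : μ = ν
      · subst hμν
        by_cases hμ : μ = 0
        · have := h1 (x 0)
          simp only [hubble] at this
          simp only [hμ, if_true]
          linarith
        · have := h2 (x 0)
          have h0 := ha (x 0)
          rw [hH] at this
          simp only [hubble] at this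
          simp only [hμ, if_true, if_false]
          have e : a (x 0) ^ 2 * (2 * (deriv (deriv a) (x 0) / a (x 0)
              - (deriv a (x 0) / a (x 0)) ^ 2) + 3 * (deriv a (x 0) / a (x 0)) ^ 2)
              = 2 * a (x 0) * deriv (deriv a) (x 0) + deriv a (x 0) ^ 2 := by
            field_simp; ring
          rw [this] at e
          linarith
      · simp only [hμν, if_false]
        split_ifs with h4 h5
        · exact absurd (h4.trans h5.symm) hμν
        all_goals ring
    · have := h3 (x 0)
      rw [hH] at this
      simp only [hubble] at this
      rw [wave_flrw hC ha hφ, gaussBonnet_flrw hC ha]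
      linarith

end FLRW
/-! ### Comparison principles on the line -/

section Comparison

variable {f f' : ℝ → ℝ}

/-- A function that decreases through each of its zeros changes sign at most once. -/
theorem neg_of_deriv_neg_of_zero (hf : ∀ t, 0 ≤ t → HasDerivAt f (f' t) t) (h0 : f 0 = 0)
    (hz : ∀ t, 0 ≤ t → f t = 0 → f' t < 0) {t : ℝ} (ht : 0 < t) : f t < 0 := by
  have hle : ∀ s ∈ Set.Icc (0 : ℝ) t, f s ≤ 0 := by
    refine image_le_of_liminf_slope_right_lt_deriv_boundary' (B := fun _ => 0) (B' := fun _ => 0)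
      (f' := f') (fun s hs => (hf s hs.1).continuousAt.continuousWithinAt) ?_ h0.le continuousOn_const
      (fun x _ => (hasDerivAt_const x (0 : ℝ)).hasDerivWithinAt) ?_
    · intro x hx r hr
      exact (hf x hx.1).hasDerivWithinAt.liminf_right_slope_le hr
    · intro x hx hfx
      exact hz x hx.1 hfx
  -- A zero at `t > 0` would have negative derivative, making `f` positive just to its left, against
  -- `hle`.
  by_contra hcon
  have hft : f t = 0 := le_antisymm (hle t ⟨ht.le, le_rfl⟩) (not_lt.1 hcon)
  have h := (hasDerivAt_iff_tendsto_slope.1 (hf t ht.le)).eventually (gt_mem_nhds (hz t ht.le hft))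
  have h' := h.filter_mono (nhdsWithin_mono t
      (fun u (hu : u < t) => hu.ne : Set.Iio t ⊆ {t}ᶜ))
  have h2 : ∀ᶠ u in nhdsWithin t (Set.Iio t), u ∈ Set.Ioo 0 t := Ioo_mem_nhdsLT ht
  have hb : (nhdsWithin t (Set.Iio t)).NeBot := inferInstance
  obtain ⟨u, hu, hu2⟩ := (Filter.Eventually.and (f := nhdsWithin t (Set.Iio t)) h' h2).exists
  rw [slope_def_field, hft, sub_zero, div_neg_iff] at hu
  rcases hu with hu | hu
  · linarith [hle u ⟨hu2.1.le, hu2.2.le⟩]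
  · linarith [hu2.2]

theorem pos_of_deriv_neg_of_zero (hf : ∀ t, t ≤ 0 → HasDerivAt f (f' t) t) (h0 : f 0 = 0)
    (hz : ∀ t, t ≤ 0 → f t = 0 → f' t < 0) {t : ℝ} (ht : t < 0) : 0 < f t := by
  have hg : ∀ s, 0 ≤ s → HasDerivAt (fun s => -f (-s)) (f' (-s)) s := by
    intro s hs
    have := ((hf (-s) (by linarith)).scomp s (hasDerivAt_neg s)).fun_neg
    simpa [Function.comp_def] using this
  have := neg_of_deriv_neg_of_zero hg (by simp [h0])
    (fun s hs h => hz (-s) (by linarith) (by linarith)) (t := -t) (by linarith)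
  simp at this
  exact this

/-- A function with positive derivative on `(0, ∞)` exceeds its initial value. -/
theorem lt_of_deriv_pos_right (hf : ∀ t, 0 ≤ t → HasDerivAt f (f' t) t)
    (h : ∀ t, 0 < t → 0 < f' t) {t : ℝ} (ht : 0 < t) : f 0 < f t := by
  refine strictMonoOn_of_deriv_pos (convex_Icc 0 t)
    (fun s hs => (hf s hs.1).continuousAt.continuousWithinAt) ?_ (Set.left_mem_Icc.2 ht.le)
    (Set.right_mem_Icc.2 ht.le) ht
  intro s hs
  rw [interior_Icc] at hs
  rw [(hf s hs.1.le).deriv]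
  exact h s hs.1

theorem lt_of_deriv_pos_left (hf : ∀ t, t ≤ 0 → HasDerivAt f (f' t) t)
    (h : ∀ t, t < 0 → 0 < f' t) {t : ℝ} (ht : t < 0) : f t < f 0 := by
  refine strictMonoOn_of_deriv_pos (convex_Icc t 0)
    (fun s hs => (hf s hs.2).continuousAt.continuousWithinAt) ?_ (Set.left_mem_Icc.2 ht.le)
    (Set.right_mem_Icc.2 ht.le) ht
  intro s hs
  rw [interior_Icc] at hs
  rw [(hf s hs.2.le).deriv]
  exact h s hs.2

/-- A solution of a linear differential inequality `|f'| ≤ C |f|` has no zeros. -/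
theorem ne_zero_of_abs_deriv_le_right (hf : ∀ t, HasDerivAt f (f' t) t) (h0 : f 0 ≠ 0)
    {T C : ℝ} (hT : 0 ≤ T) (hC : ∀ t ∈ Set.Icc 0 T, |f' t| ≤ C * |f t|) : f T ≠ 0 := by
  -- Grönwall in multiplicative form: `(f²)' ≥ -2C f²` makes `f² exp(2Ct)` nondecreasing, so it
  -- stays above `f(0)² > 0`.
  have hg : ∀ t, HasDerivAt (fun t => f t ^ 2 * Real.exp (2 * C * t))
      ((2 * f t * f' t + 2 * C * f t ^ 2) * Real.exp (2 * C * t)) t := by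
    intro t
    have h1 := (hf t).fun_pow 2
    have h2 := ((hasDerivAt_id t).const_mul (2 * C)).exp
    have := h1.fun_mul h2
    simp only [id] at this
    refine this.congr_deriv ?_
    simp
    ring
  have hmono : MonotoneOn (fun t => f t ^ 2 * Real.exp (2 * C * t)) (Set.Icc 0 T) := by
    refine monotoneOn_of_deriv_nonneg (convex_Icc 0 T)
      (fun s _ => (hg s).continuousAt.continuousWithinAt)
      (fun s _ => (hg s).differentiableAt.differentiableWithinAt) ?_
    intro s hs
    rw [interior_Icc] at hs
    rw [(hg s).deriv]
    refine mul_nonneg ?_ (Real.exp_pos _).le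
    have h1 := hC s ⟨hs.1.le, hs.2.le⟩
    have h2 : |f s * f' s| ≤ C * f s ^ 2 := by
      rw [abs_mul, ← sq_abs]
      nlinarith [abs_nonneg (f s)]
    linarith [neg_abs_le (f s * f' s)]
  have := hmono (Set.left_mem_Icc.2 hT) (Set.right_mem_Icc.2 hT) hT
  simp only [mul_zero, Real.exp_zero, mul_one] at this
  intro hT0
  rw [hT0] at this
  have : 0 < f 0 ^ 2 := by positivity
  norm_num at *
  exact h0 ‹_›

theorem pos_of_ne_zero (hc : Continuous f) (h0 : 0 < f 0) (hne : ∀ t, f t ≠ 0) (t : ℝ) :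
    0 < f t := by
  by_contra hcon
  have h : (0 : ℝ) ∈ Set.uIcc (f 0) (f t) := Set.mem_uIcc.2 (Or.inr ⟨not_lt.1 hcon, h0.le⟩)
  obtain ⟨s, -, hs⟩ := intermediate_value_uIcc hc.continuousOn h
  exact hne s hs

/-- A solution of a linear differential inequality keeps its sign. -/
theorem pos_of_abs_deriv_le (hf : ∀ t, HasDerivAt f (f' t) t) (h0 : 0 < f 0)
    (hC : ∀ T, 0 ≤ T → ∃ C, ∀ t ∈ Set.Icc (-T) T, |f' t| ≤ C * |f t|) (t : ℝ) : 0 < f t := by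
  have hc : Continuous f := continuous_iff_continuousAt.2 fun s => (hf s).continuousAt
  refine pos_of_ne_zero hc h0 (fun t => ?_) t
  obtain ⟨C, hC⟩ := hC |t| (abs_nonneg t)
  rcases le_total 0 t with ht | ht
  · rw [abs_of_nonneg ht] at hC
    exact ne_zero_of_abs_deriv_le_right hf h0.ne' ht
      fun s hs => hC s ⟨by linarith [hs.1], hs.2⟩
  · rw [abs_of_nonpos ht] at hC
    have hg : ∀ s, HasDerivAt (fun s => f (-s)) (-f' (-s)) s := by
      intro s
      have := (hf (-s)).scomp s (hasDerivAt_neg s)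
      simpa [Function.comp_def] using this
    have := ne_zero_of_abs_deriv_le_right hg (by simpa using h0.ne') (T := -t) (C := C)
      (by linarith) (fun s hs => by
        rw [abs_neg]
        exact hC (-s) ⟨by linarith [hs.2], by linarith [hs.1]⟩)
    simpa using this

end Comparison

/-! ### Global solutions of bounded Lipschitz differential equations -/

/-- A bound `M` on the field lets Picard–Lindelöf run on any interval `[-(n+1), n+1]`, with a ball
of radius `M(n+1)`. Uniqueness makes these solutions agree on overlaps, so they glue. -/
theorem exists_hasDerivAt_of_bounded_lipschitz {E : Type*} [NormedAddCommGroup E]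
    [NormedSpace ℝ E] [CompleteSpace E] {v : E → E} {K M : NNReal} (hK : LipschitzWith K v)
    (hM : ∀ x, ‖v x‖ ≤ M) (x₀ : E) :
    ∃ α : ℝ → E, α 0 = x₀ ∧ ∀ t, HasDerivAt α (v (α t)) t := by
  have hloc : ∀ n : ℕ, ∃ α : ℝ → E, α 0 = x₀ ∧
      ∀ t ∈ Set.Ioo (-(n + 1 : ℝ)) (n + 1), HasDerivAt α (v (α t)) t := by
    intro n
    have hn : (0 : ℝ) ≤ n := n.cast_nonneg
    have hPL : IsPicardLindelof (fun _ => v) (tmin := -(n + 1 : ℝ)) (tmax := n + 1)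
        ⟨0, by constructor <;> linarith⟩ x₀ (M * (n + 1)) 0 M K := by
      refine IsPicardLindelof.of_time_independent (fun x _ => hM x) hK.lipschitzOnWith ?_
      simp
    obtain ⟨α, h0, hα⟩ := hPL.exists_eq_forall_mem_Icc_hasDerivWithinAt₀
    exact ⟨α, h0, fun t ht => (hα t (Set.Ioo_subset_Icc_self ht)).hasDerivAt
      (Icc_mem_nhds ht.1 ht.2)⟩
  choose α h0 hα using hloc
  have hag : ∀ m n : ℕ, m ≤ n → ∀ t ∈ Set.Ioo (-(m + 1 : ℝ)) (m + 1), α m t = α n t := by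
    intro m n hmn
    have hm : (0 : ℝ) ≤ m := m.cast_nonneg
    have hmn' : (m : ℝ) ≤ n := by exact_mod_cast hmn
    refine ODE_solution_unique_of_mem_Ioo (v := fun _ => v) (s := fun _ => Set.univ) (t₀ := 0)
      (fun t _ => hK.lipschitzOnWith) ⟨by linarith, by linarith⟩
      (fun t ht => ⟨hα m t ht, trivial⟩)
      (fun t ht => ⟨hα n t ⟨by linarith [ht.1], by linarith [ht.2]⟩, trivial⟩)
      ((h0 m).trans (h0 n).symm)
  -- The index `⌈|t|⌉₊` suffices because the `n`-th solution lives on the larger interval of radius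
  -- `n + 1`, so `t` is an interior point.
  refine ⟨fun t => α ⌈|t|⌉₊ t, h0 _, fun t => ?_⟩
  have hmem : ∀ s : ℝ, ∀ n : ℕ, ⌈|s|⌉₊ ≤ n → s ∈ Set.Ioo (-(n + 1 : ℝ)) (n + 1) := by
    intro s n hs
    have h1 : |s| ≤ n := (Nat.le_ceil _).trans (by exact_mod_cast hs)
    have := abs_le.1 h1
    exact ⟨by linarith [this.1], by linarith [this.2]⟩
  have ht := hmem t _ le_rfl
  have hev : (fun s => α ⌈|s|⌉₊ s) =ᶠ[nhds t] α (⌈|t|⌉₊) := by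
    filter_upwards [Ioo_mem_nhds ht.1 ht.2] with s hs
    rcases le_total ⌈|s|⌉₊ ⌈|t|⌉₊ with h | h
    · exact hag _ _ h s (hmem s _ le_rfl)
    · exact (hag _ _ h s hs).symm
  exact (hα _ t ht).congr_of_eventuallyEq hev

/-! ### The planar system for `H` and `q = φ̇² / (3 H²)` -/

/-- The derivative of `H` along a solution. -/
noncomputable def speedH (h q : ℝ) : ℝ :=
  h ^ 2 * (24 * h ^ 2 * q ^ 2 - (5 * q + 1) * (q + 1)) / (1 - 2 * q + 5 * q ^ 2)

/-- The derivative of `q` along a solution. -/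
noncomputable def speedQ (h q : ℝ) : ℝ :=
  -(4 * h * q * ((5 * q + 1) * (q - 1) + 6 * h ^ 2 * q * (1 + q))) / (1 - 2 * q + 5 * q ^ 2)

/-- A solution `(H, q)` of the planar system, where `H` may have been cut off to `h` in the
vector field as long as this has no effect for `H ≤ 1`. -/
structure IsFlow (β : ℝ) (h H q : ℝ → ℝ) : Prop where
  cutoff_pos : ∀ t, 0 < h t
  cutoff_eq : ∀ t, H t ≤ 1 → h t = H t
  q_pos : ∀ t, 0 < q t
  hasDerivAt_H : ∀ t, HasDerivAt H (speedH (h t) (q t)) t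
  hasDerivAt_q : ∀ t, HasDerivAt q (speedQ (h t) (q t)) t
  H_init : H 0 = β
  q_init : q 0 = 1

/-! ### Pointwise estimates of the planar field and the Riccati barriers. -/

theorem quad_pos (q : ℝ) : 0 < 1 - 2 * q + 5 * q ^ 2 := by nlinarith [sq_nonneg (5 * q - 1)]

theorem neg_five_lt_speedH {h q : ℝ} (hh : 0 < h) (hq : 0 < q) :
    -(5 * h ^ 2) < speedH h q := by
  rw [speedH, lt_div_iff₀ (quad_pos q)]
  have h1 : 0 < 24 * h ^ 2 * q ^ 2 := by positivity
  have h2 : 0 < h ^ 2 := by positivity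
  nlinarith [mul_pos h2 h1, mul_nonneg h2.le (sq_nonneg (5 * q - 2))]

/-- The numerator of `speedH + h²` is exactly `-8 h² q (1 - 3h²q)`. -/
theorem speedH_lt_neg {h q : ℝ} (hh : 0 < h) (hq : 0 < q) (hX : 3 * h ^ 2 * q < 1) :
    speedH h q < -h ^ 2 := by
  rw [speedH, div_lt_iff₀ (quad_pos q)]
  have h2 : 0 < h ^ 2 * (8 * q * (1 - 3 * h ^ 2 * q)) := by
    have := sub_pos.2 hX
    positivity
  nlinarith

/-- At `q = 1` the speed is `3h²(2h² - 1)`, convex in `h²`. The bound is its tangent at the zero `h²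
= 1/2`, and the resulting gap is a multiple of `(2h² - 1)²`. -/
theorem lt_speedH_of_one_le {h q : ℝ} (hq : 1 ≤ q) (hX : h ^ 2 < 1 / 2) :
    -(3 / 2 * (1 - 2 * h ^ 2)) < speedH h q := by
  rw [speedH, lt_div_iff₀ (quad_pos q)]
  have h1 : 0 < q ^ 2 * (2 * h ^ 2 - 1) ^ 2 := by
    have : 2 * h ^ 2 - 1 ≠ 0 := by linarith
    have : 0 < q := by linarith
    positivity
  have h2 : 0 ≤ (q - 1) * (q + 1) * h ^ 2 :=
    mul_nonneg (mul_nonneg (by linarith) (by linarith)) (sq_nonneg _)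
  nlinarith [sq_nonneg (q - 1)]

/-- The right side is the limit of `speedH` as `q → ∞`. The difference of the numerators, up to the
factor `h²`, is `(24/5)h²(2q - 1) - 8q`, which is at most `-4` when `h² ≤ 5/6`. -/
theorem speedH_lt_of_one_le {h q : ℝ} (hh : 0 < h) (hq : 1 ≤ q) (hX : h ^ 2 ≤ 5 / 6) :
    speedH h q < h ^ 2 * (24 / 5 * h ^ 2 - 1) := by
  rw [speedH, div_lt_iff₀ (quad_pos q), mul_assoc (h ^ 2)]
  have h2 : 0 < h ^ 2 := by positivity
  refine mul_lt_mul_of_pos_left ?_ h2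
  nlinarith [mul_nonneg (by linarith : 0 ≤ 2 * q - 1) (by linarith : 0 ≤ 5 / 6 - h ^ 2)]

theorem speedQ_one_neg {h : ℝ} (hh : 0 < h) : speedQ h 1 < 0 := by
  rw [speedQ, div_neg_iff]
  right
  norm_num
  positivity

theorem hasDerivAt_future_barrier {β c t : ℝ} (hβ : 0 < β) (hc : 0 < c) (ht : 0 ≤ t) :
    HasDerivAt (fun t => 1 / (c * t + 1 / β)) (-(c * (1 / (c * t + 1 / β)) ^ 2)) t := by
  have h0 : c * t + 1 / β ≠ 0 := by positivity
  have := (((hasDerivAt_id t).const_mul c).add_const (1 / β)).fun_inv (by simpa using h0)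
  simp only [id, ← one_div] at this
  refine this.congr_deriv ?_
  field_simp

/-- The upper bound for `H` in the past. -/
noncomputable def hubbleCeil (β t : ℝ) : ℝ :=
  (2 * β + Real.sqrt 2 - (Real.sqrt 2 - 2 * β) * Real.exp (3 * Real.sqrt 2 * t)) /
    (Real.sqrt 2 *
      (2 * β + Real.sqrt 2 + (Real.sqrt 2 - 2 * β) * Real.exp (3 * Real.sqrt 2 * t)))

theorem sqrt_two_sub_pos {β : ℝ} (hβ : β ^ 2 < 1 / 3) : 0 < Real.sqrt 2 - 2 * β := by
  have : 2 * β < Real.sqrt 2 := by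
    apply Real.lt_sqrt_of_sq_lt
    nlinarith
  linarith

theorem hubbleCeil_denom_pos {β : ℝ} (h0 : 0 < β) (hβ : β ^ 2 < 1 / 3) (t : ℝ) :
    0 < 2 * β + Real.sqrt 2 + (Real.sqrt 2 - 2 * β) * Real.exp (3 * Real.sqrt 2 * t) := by
  have := sqrt_two_sub_pos hβ
  positivity

theorem hubbleCeil_zero {β : ℝ} : hubbleCeil β 0 = β := by
  have h : Real.sqrt 2 ≠ 0 := by positivity
  have hs := Real.sq_sqrt (show (0 : ℝ) ≤ 2 by norm_num)
  have hD : 2 * β + Real.sqrt 2 + (Real.sqrt 2 - 2 * β) * 1 = 2 * Real.sqrt 2 := by ring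
  simp only [hubbleCeil, mul_zero, Real.exp_zero]
  rw [hD, div_eq_iff (by positivity)]
  linear_combination (-2 * β) * hs

/-- This is the Riccati equation matching `lt_speedH_of_one_le`. Its equilibrium `1/√2` caps `H` in
the past. -/
theorem hasDerivAt_hubbleCeil {β : ℝ} (h0 : 0 < β) (hβ : β ^ 2 < 1 / 3) (t : ℝ) :
    HasDerivAt (hubbleCeil β) (-(3 / 2 * (1 - 2 * hubbleCeil β t ^ 2))) t := by
  have hD := (hubbleCeil_denom_pos h0 hβ t).ne'
  have h2 : Real.sqrt 2 ≠ 0 := by positivity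
  have hs := Real.sq_sqrt (show (0 : ℝ) ≤ 2 by norm_num)
  have he : HasDerivAt (fun t => (Real.sqrt 2 - 2 * β) * Real.exp (3 * Real.sqrt 2 * t))
      ((Real.sqrt 2 - 2 * β) * (Real.exp (3 * Real.sqrt 2 * t) * (3 * Real.sqrt 2))) t := by
    have := (((hasDerivAt_id t).const_mul (3 * Real.sqrt 2)).exp).const_mul (Real.sqrt 2 - 2 * β)
    simpa using this
  have := (he.const_sub (2 * β + Real.sqrt 2)).fun_div
    ((he.const_add (2 * β + Real.sqrt 2)).const_mul (Real.sqrt 2)) (mul_ne_zero h2 hD)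
  refine this.congr_deriv ?_
  simp only [hubbleCeil]
  generalize Real.exp (3 * Real.sqrt 2 * t) = e at *
  generalize Real.sqrt 2 = s at *
  field_simp
  rw [show s ^ 2 = 2 from hs]
  ring

theorem hubbleCeil_sq_lt {β : ℝ} (h0 : 0 < β) (hβ : β ^ 2 < 1 / 3) {t : ℝ} (ht : t ≤ 0) :
    0 < hubbleCeil β t ∧ hubbleCeil β t ^ 2 < 1 / 2 := by
  have hD := hubbleCeil_denom_pos h0 hβ t
  have hA := sqrt_two_sub_pos hβ
  have h2 : 0 < Real.sqrt 2 := by positivity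
  have hs := Real.sq_sqrt (show (0 : ℝ) ≤ 2 by norm_num)
  have he : Real.exp (3 * Real.sqrt 2 * t) ≤ 1 :=
    Real.exp_le_one_iff.2 (mul_nonpos_of_nonneg_of_nonpos (by positivity) ht)
  have he0 := Real.exp_pos (3 * Real.sqrt 2 * t)
  have hN : 0 < 2 * β + Real.sqrt 2 - (Real.sqrt 2 - 2 * β) * Real.exp (3 * Real.sqrt 2 * t) := by
    nlinarith
  have hlt := mul_pos hA he0
  simp only [hubbleCeil]
  refine ⟨by positivity, ?_⟩
  rw [div_pow, mul_pow, hs, div_lt_iff₀ (by positivity)]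
  nlinarith

namespace IsFlow

/-! ### A priori bounds that make the cutoff inactive. -/

variable {β : ℝ} {h H q : ℝ → ℝ}

theorem one_lt_q (hf : IsFlow β h H q) {t : ℝ} (ht : t < 0) : 1 < q t := by
  have := pos_of_deriv_neg_of_zero (f := fun t => q t - 1)
    (fun t _ => (hf.hasDerivAt_q t).sub_const 1) (by simp [hf.q_init])
    (fun t _ h1 => by rw [sub_eq_zero.1 h1]; exact speedQ_one_neg (hf.cutoff_pos t)) ht
  linarith

theorem q_lt_one (hf : IsFlow β h H q) {t : ℝ} (ht : 0 < t) : q t < 1 := by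
  have := neg_of_deriv_neg_of_zero (f := fun t => q t - 1)
    (fun t _ => (hf.hasDerivAt_q t).sub_const 1) (by simp [hf.q_init])
    (fun t _ h1 => by rw [sub_eq_zero.1 h1]; exact speedQ_one_neg (hf.cutoff_pos t)) ht
  linarith

theorem one_le_q (hf : IsFlow β h H q) {t : ℝ} (ht : t ≤ 0) : 1 ≤ q t := by
  rcases ht.lt_or_eq with h | rfl
  · exact (hf.one_lt_q h).le
  · exact hf.q_init.ge

theorem q_le_one (hf : IsFlow β h H q) {t : ℝ} (ht : 0 ≤ t) : q t ≤ 1 := by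
  rcases ht.lt_or_eq with h | rfl
  · exact (hf.q_lt_one h).le
  · exact hf.q_init.le

theorem H_lt_past (hf : IsFlow β h H q) (h0 : 0 < β) (hβ : β ^ 2 < 1 / 3) {t : ℝ}
    (ht : t < 0) : H t < hubbleCeil β t := by
  have := pos_of_deriv_neg_of_zero (f := fun t => hubbleCeil β t - H t)
    (fun t _ => (hasDerivAt_hubbleCeil h0 hβ t).fun_sub (hf.hasDerivAt_H t))
    (by simp [hf.H_init, hubbleCeil_zero])
    (fun t ht h1 => by
      obtain ⟨hc0, hc⟩ := hubbleCeil_sq_lt h0 hβ ht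
      have he : hubbleCeil β t = H t := sub_eq_zero.1 h1
      rw [he] at hc0 hc ⊢
      -- Only the contact point matters, and there `H² < 1/2`. The barrier thus works for the
      -- cut-off field, before `H ≤ 1` is known globally.
      have hh := hf.cutoff_eq t (by nlinarith)
      rw [hh]
      linarith [lt_speedH_of_one_le (hf.one_le_q ht) hc]) ht
  linarith

theorem H_lt_future (hf : IsFlow β h H q) (h0 : 0 < β) (hβ : β ^ 2 < 1 / 3) {t : ℝ}
    (ht : 0 < t) : H t < 1 / (t + 1 / β) := by
  have := neg_of_deriv_neg_of_zero (f := fun t => H t - 1 / (1 * t + 1 / β))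
    (fun t ht => (hf.hasDerivAt_H t).fun_sub (hasDerivAt_future_barrier h0 one_pos ht))
    (by simp [hf.H_init])
    (fun t ht h1 => by
      have he : H t = 1 / (1 * t + 1 / β) := sub_eq_zero.1 h1
      have hp : 0 < H t := by rw [he]; positivity
      have hle : H t ≤ β := by
        rw [he, one_mul, div_le_iff₀ (by positivity)]
        have : β * (1 / β) = 1 := by field_simp
        nlinarith
      rw [hf.cutoff_eq t (by nlinarith), ← he]
      have hq := hf.q_le_one ht
      have hq0 := hf.q_pos t
      -- The smallness of `β` enters here: at a contact `H ≤ β`, and `q ≤ 1` in the future, so `3H²q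
      -- ≤ 3β² < 1`.
      have h3 : 3 * H t ^ 2 * q t < 1 := by
        have : H t ^ 2 ≤ β ^ 2 := by gcongr
        nlinarith [sq_nonneg (H t)]
      linarith [speedH_lt_neg hp hq0 h3]) ht
  simp only [one_mul] at this
  linarith

theorem H_lt_one (hf : IsFlow β h H q) (h0 : 0 < β) (hβ : β ^ 2 < 1 / 3) (t : ℝ) :
    H t < 1 := by
  have hβ1 : β < 1 := by nlinarith
  rcases lt_trichotomy t 0 with ht | rfl | ht
  · have := hf.H_lt_past h0 hβ ht
    obtain ⟨-, h2⟩ := hubbleCeil_sq_lt h0 hβ ht.le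
    nlinarith
  · rwa [hf.H_init]
  · have := hf.H_lt_future h0 hβ ht
    have h2 : 1 / (t + 1 / β) ≤ β := by
      rw [div_le_iff₀ (by positivity)]
      have : β * (1 / β) = 1 := by field_simp
      nlinarith
    linarith

theorem cutoff_removed (hf : IsFlow β h H q) (h0 : 0 < β) (hβ : β ^ 2 < 1 / 3) :
    IsFlow β H H q := by
  have : h = H := funext fun t => hf.cutoff_eq t (hf.H_lt_one h0 hβ t).le
  rwa [this] at hf

end IsFlow
/-! ### Existence and uniqueness for the planar system -/

/-- The planar system in the coordinates `(H, θ)` with `θ = q / (1 + q)`. -/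
noncomputable def flowField (p : ℝ × ℝ) : ℝ × ℝ :=
  (p.1 ^ 2 * (24 * p.1 ^ 2 * p.2 ^ 2 - (1 + 4 * p.2)) / (1 - 4 * p.2 + 8 * p.2 ^ 2),
    -(4 * p.1 * p.2 * (1 - p.2) * ((1 + 4 * p.2) * (2 * p.2 - 1) + 6 * p.1 ^ 2 * p.2))
      / (1 - 4 * p.2 + 8 * p.2 ^ 2))

/-- The projection of `ℝ` onto `[0, 1]`. -/
noncomputable def clip (x : ℝ) : ℝ := Set.projIcc (0 : ℝ) 1 zero_le_one x

theorem clip_mem (x : ℝ) : clip x ∈ Set.Icc (0 : ℝ) 1 := (Set.projIcc 0 1 zero_le_one x).2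

theorem clip_of_mem {x : ℝ} (hx : x ∈ Set.Icc (0 : ℝ) 1) : clip x = x := by
  rw [clip, Set.projIcc_of_mem _ hx]

theorem clip_pos {x : ℝ} (hx : 0 < x) : 0 < clip x := by
  simp [clip, Set.coe_projIcc, hx]

theorem clip_le {x : ℝ} (hx : 0 ≤ x) : clip x ≤ x := by
  simp [clip, Set.coe_projIcc, hx]

theorem abs_clip_le (x : ℝ) : |clip x| ≤ |x| := by
  rcases le_total 0 x with h | h
  · rw [abs_of_nonneg (clip_mem x).1, abs_of_nonneg h]
    exact clip_le h
  · have : clip x = 0 := by simp [clip, Set.projIcc_of_le_left _ h]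
    simp [this]

theorem abs_one_sub_clip_le (x : ℝ) : |1 - clip x| ≤ |1 - x| := by
  rcases le_total x 1 with h | h
  · rw [abs_of_nonneg (sub_nonneg.2 (clip_mem x).2), abs_of_nonneg (sub_nonneg.2 h)]
    have : x ≤ clip x := by simp [clip, Set.coe_projIcc, h]
    linarith
  · have : clip x = 1 := by simp [clip, Set.projIcc_of_right_le _ h]
    simp [this]

theorem lipschitzWith_clip : LipschitzWith 1 clip := by
  have := (LipschitzWith.subtype_val (Set.Icc (0 : ℝ) 1)).comp
    (LipschitzWith.projIcc (zero_le_one (α := ℝ)))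
  rw [one_mul] at this
  exact this

/-- The planar system with arguments projected to `[0, 1]²`. -/
noncomputable def clippedField (p : ℝ × ℝ) : ℝ × ℝ := flowField (clip p.1, clip p.2)

theorem theta_quad_pos (x : ℝ) : 0 < 1 - 4 * x + 8 * x ^ 2 := by
  nlinarith [sq_nonneg (4 * x - 1)]

theorem contDiff_flowField : ContDiff ℝ 1 flowField := by
  unfold flowField
  refine ContDiff.prodMk (ContDiff.div ?_ ?_ fun p => (theta_quad_pos p.2).ne')
    (ContDiff.div ?_ ?_ fun p => (theta_quad_pos p.2).ne') <;> fun_prop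

theorem exists_lipschitzWith_clippedField : ∃ K, LipschitzWith K clippedField := by
  obtain ⟨K, hK⟩ := contDiff_flowField.contDiffOn.exists_lipschitzOnWith one_ne_zero
    ((convex_Icc (0 : ℝ) 1).prod (convex_Icc (0 : ℝ) 1)) (isCompact_Icc.prod isCompact_Icc)
  have hc : LipschitzWith 1 (fun p : ℝ × ℝ => (clip p.1, clip p.2)) := by
    have := (lipschitzWith_clip.comp (LipschitzWith.prod_fst (α := ℝ) (β := ℝ))).prodMk
      (lipschitzWith_clip.comp (LipschitzWith.prod_snd (α := ℝ) (β := ℝ)))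
    simpa [Function.comp_def] using this
  refine ⟨K * 1, ?_⟩
  rw [← lipschitzOnWith_univ] at hc ⊢
  exact hK.comp hc fun p _ => ⟨clip_mem _, clip_mem _⟩

theorem exists_bound_clippedField : ∃ M : NNReal, ∀ p, ‖clippedField p‖ ≤ M := by
  obtain ⟨M, hM⟩ := ((isCompact_Icc (a := (0 : ℝ)) (b := 1)).prod
    (isCompact_Icc (a := (0 : ℝ)) (b := 1))).exists_bound_of_continuousOn
      contDiff_flowField.continuous.continuousOn
  refine ⟨M.toNNReal, fun p => (hM _ ⟨clip_mem p.1, clip_mem p.2⟩).trans ?_⟩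
  exact Real.le_coe_toNNReal M

theorem hasDerivAt_prod_iff {f : ℝ → ℝ × ℝ} {v : ℝ × ℝ} {t : ℝ} :
    HasDerivAt f v t ↔ HasDerivAt (fun t => (f t).1) v.1 t ∧ HasDerivAt (fun t => (f t).2) v.2 t := by
  constructor
  · intro h
    exact ⟨(hasFDerivAt_fst.comp_hasDerivAt t h :), (hasFDerivAt_snd.comp_hasDerivAt t h :)⟩
  · rintro ⟨h1, h2⟩
    exact h1.prodMk h2

theorem speedH_eq_flowField {x y : ℝ} (hy : y ≠ 1) :
    (flowField (x, y)).1 = speedH x (y / (1 - y)) := by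
  have h1 : 1 - y ≠ 0 := sub_ne_zero.2 hy.symm
  have h2 := (theta_quad_pos y).ne'
  have h3 := (quad_pos (y / (1 - y))).ne'
  rw [speedH]
  simp only [flowField]
  rw [div_eq_div_iff h2 h3]
  field_simp
  ring

/-- With `q = θ/(1 - θ)` the factor `1/(1 - y)²` is `dq/dθ`. -/
theorem speedQ_eq_flowField {x y : ℝ} (hy : y ≠ 1) :
    (flowField (x, y)).2 / (1 - y) ^ 2 = speedQ x (y / (1 - y)) := by
  have h1 : 1 - y ≠ 0 := sub_ne_zero.2 hy.symm
  have h2 := (theta_quad_pos y).ne'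
  have h3 := (quad_pos (y / (1 - y))).ne'
  rw [speedQ]
  simp only [flowField]
  rw [div_div, div_eq_div_iff (by positivity) h3]
  field_simp
  ring

/-- The clipped system has a global solution from `(β, 1/2)`, where `θ = 1/2` means `q = 1`. The
field has factors `H` and `θ(1 - θ)`, so `H > 0` and `0 < θ < 1` persist. Clipping can then change
only `H` above `1`, which is the cutoff that `cutoff_removed` eliminates. -/
theorem exists_isFlow {β : ℝ} (h0 : 0 < β) (hβ : β ^ 2 < 1 / 3) :
    ∃ H q : ℝ → ℝ, IsFlow β H H q := by
  obtain ⟨K, hK⟩ := exists_lipschitzWith_clippedField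
  obtain ⟨M, hM⟩ := exists_bound_clippedField
  obtain ⟨α, hα0, hα⟩ := exists_hasDerivAt_of_bounded_lipschitz hK hM (β, 1 / 2)
  have h1 := fun t => (hasDerivAt_prod_iff.1 (hα t)).1
  have h2 := fun t => (hasDerivAt_prod_iff.1 (hα t)).2
  -- One bound on the cofactors left after extracting `x` from the first component and `-y(1 - y)`
  -- from the second. It gives the linear inequalities for `H`, `θ` and `1 - θ`.
  obtain ⟨C, hC⟩ : ∃ C, ∀ x ∈ Set.Icc (0 : ℝ) 1, ∀ y ∈ Set.Icc (0 : ℝ) 1,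
      |x * (24 * x ^ 2 * y ^ 2 - (1 + 4 * y)) / (1 - 4 * y + 8 * y ^ 2)| ≤ C ∧
      |4 * x * ((1 + 4 * y) * (2 * y - 1) + 6 * x ^ 2 * y) / (1 - 4 * y + 8 * y ^ 2)| ≤ C := by
    have hcont : Continuous fun p : ℝ × ℝ =>
        (p.1 * (24 * p.1 ^ 2 * p.2 ^ 2 - (1 + 4 * p.2)) / (1 - 4 * p.2 + 8 * p.2 ^ 2),
        4 * p.1 * ((1 + 4 * p.2) * (2 * p.2 - 1) + 6 * p.1 ^ 2 * p.2)
          / (1 - 4 * p.2 + 8 * p.2 ^ 2)) := by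
      refine Continuous.prodMk (Continuous.div (by fun_prop) (by fun_prop)
        fun p => (theta_quad_pos p.2).ne') (Continuous.div (by fun_prop) (by fun_prop)
        fun p => (theta_quad_pos p.2).ne')
    obtain ⟨C, hC⟩ := ((isCompact_Icc (a := (0 : ℝ)) (b := 1)).prod
      (isCompact_Icc (a := (0 : ℝ)) (b := 1))).exists_bound_of_continuousOn hcont.continuousOn
    refine ⟨C, fun x hx y hy => ?_⟩
    have := hC (x, y) ⟨hx, hy⟩
    exact ⟨(norm_fst_le _).trans this, (norm_snd_le _).trans this⟩
  have hHpos : ∀ t, 0 < (α t).1 := by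
    refine pos_of_abs_deriv_le h1 (by simpa [hα0] using h0) fun T _ => ⟨C, fun t _ => ?_⟩
    have hx := clip_mem (α t).1
    have hy := clip_mem (α t).2
    have e : (clippedField (α t)).1 = clip (α t).1 * (24 * clip (α t).1 ^ 2 * clip (α t).2 ^ 2
        - (1 + 4 * clip (α t).2)) / (1 - 4 * clip (α t).2 + 8 * clip (α t).2 ^ 2)
        * clip (α t).1 := by
      simp only [clippedField, flowField]; ring
    rw [e, abs_mul]
    have hC' := (hC _ hx _ hy).1
    exact mul_le_mul hC' (abs_clip_le _) (abs_nonneg _) ((abs_nonneg _).trans hC')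
  have e : ∀ t, (clippedField (α t)).2 = -(4 * clip (α t).1 * ((1 + 4 * clip (α t).2)
        * (2 * clip (α t).2 - 1) + 6 * clip (α t).1 ^ 2 * clip (α t).2)
        / (1 - 4 * clip (α t).2 + 8 * clip (α t).2 ^ 2)) * clip (α t).2
        * (1 - clip (α t).2) := by
    intro t
    simp only [clippedField, flowField]; ring
  have hθpos : ∀ t, 0 < (α t).2 := by
    refine pos_of_abs_deriv_le h2 (by simp [hα0]) fun T _ => ⟨C, fun t _ => ?_⟩
    have hx := clip_mem (α t).1
    have hy := clip_mem (α t).2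
    rw [e, abs_mul, abs_mul, abs_neg]
    have hC' := (hC _ hx _ hy).2
    have h3 : |1 - clip (α t).2| ≤ 1 := abs_le.2 ⟨by linarith [hy.2], by linarith [hy.1]⟩
    have h4 := mul_le_mul hC' (abs_clip_le (α t).2) (abs_nonneg _) ((abs_nonneg _).trans hC')
    calc _ ≤ (C * |(α t).2|) * 1 := mul_le_mul h4 h3 (abs_nonneg _)
          (mul_nonneg ((abs_nonneg _).trans hC') (abs_nonneg _))
      _ = _ := mul_one _
  have hθlt : ∀ t, 0 < 1 - (α t).2 := by
    refine pos_of_abs_deriv_le (fun t => (h2 t).const_sub 1) (by norm_num [hα0])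
      fun T _ => ⟨C, fun t _ => ?_⟩
    have hx := clip_mem (α t).1
    have hy := clip_mem (α t).2
    rw [e, abs_neg, abs_mul, abs_mul, abs_neg]
    have hC' := (hC _ hx _ hy).2
    have h3 : |clip (α t).2| ≤ 1 := abs_le.2 ⟨by linarith [hy.1], hy.2⟩
    have h4 := mul_le_mul hC' h3 (abs_nonneg _) ((abs_nonneg _).trans hC')
    rw [mul_one] at h4
    exact mul_le_mul h4 (abs_one_sub_clip_le _) (abs_nonneg _) ((abs_nonneg _).trans hC')
  have hclip : ∀ t, clip (α t).2 = (α t).2 := fun t =>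
    clip_of_mem ⟨(hθpos t).le, (sub_pos.1 (hθlt t)).le⟩
  refine ⟨fun t => (α t).1, fun t => (α t).2 / (1 - (α t).2),
    (IsFlow.cutoff_removed (h := fun t => clip (α t).1) ⟨fun t => clip_pos (hHpos t),
      fun t ht => clip_of_mem ⟨(hHpos t).le, ht⟩, fun t => div_pos (hθpos t) (hθlt t),
      fun t => ?_, fun t => ?_, ?_, ?_⟩ h0 hβ)⟩
  · rw [← speedH_eq_flowField (sub_pos.1 (hθlt t)).ne]
    have := h1 t
    rwa [clippedField, hclip] at this
  · rw [← speedQ_eq_flowField (sub_pos.1 (hθlt t)).ne]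
    have := (h2 t).fun_div ((h2 t).const_sub 1) (hθlt t).ne'
    rw [clippedField, hclip] at this
    refine this.congr_deriv ?_
    congr 1
    ring
  · simp [hα0]
  · norm_num [hα0]

namespace IsFlow

variable {β : ℝ} {H q H₁ q₁ H₂ q₂ : ℝ → ℝ}

theorem H_pos (hf : IsFlow β H H q) (t : ℝ) : 0 < H t := hf.cutoff_pos t

theorem hasDerivAt_clippedField (hf : IsFlow β H H q) (h0 : 0 < β) (hβ : β ^ 2 < 1 / 3) (t : ℝ) :
    HasDerivAt (fun t => (H t, q t / (1 + q t))) (clippedField (H t, q t / (1 + q t))) t := by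
  have hq := hf.q_pos t
  have hq1 : 0 < 1 + q t := by linarith
  have hθ : q t / (1 + q t) < 1 := (div_lt_one hq1).2 (by linarith)
  have hθ0 : 0 < q t / (1 + q t) := by positivity
  have e : q t / (1 + q t) / (1 - q t / (1 + q t)) = q t := by field_simp; ring
  rw [clippedField, clip_of_mem ⟨(hf.H_pos t).le, (hf.H_lt_one h0 hβ t).le⟩,
    clip_of_mem ⟨hθ0.le, hθ.le⟩]
  refine hasDerivAt_prod_iff.2 ⟨?_, ?_⟩
  · rw [speedH_eq_flowField hθ.ne, e]
    exact hf.hasDerivAt_H t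
  · have h1 := speedQ_eq_flowField (x := H t) hθ.ne
    rw [e] at h1
    have h2 := (hf.hasDerivAt_q t).fun_div ((hf.hasDerivAt_q t).const_add 1) hq1.ne'
    refine h2.congr_deriv ?_
    rw [← h1]
    have h3 : 1 - q t / (1 + q t) = 1 / (1 + q t) := by field_simp; ring
    rw [h3]
    field_simp
    ring

theorem unique (hf₁ : IsFlow β H₁ H₁ q₁) (hf₂ : IsFlow β H₂ H₂ q₂) (h0 : 0 < β)
    (hβ : β ^ 2 < 1 / 3) : H₁ = H₂ ∧ q₁ = q₂ := by
  obtain ⟨K, hK⟩ := exists_lipschitzWith_clippedField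
  have h := ODE_solution_unique_univ (v := fun _ => clippedField) (s := fun _ => Set.univ)
    (t₀ := 0) (fun t => hK.lipschitzOnWith)
    (fun t => ⟨hf₁.hasDerivAt_clippedField h0 hβ t, trivial⟩)
    (fun t => ⟨hf₂.hasDerivAt_clippedField h0 hβ t, trivial⟩)
    (by simp [hf₁.H_init, hf₂.H_init, hf₁.q_init, hf₂.q_init])
  refine ⟨funext fun t => congrArg Prod.fst (congrFun h t), funext fun t => ?_⟩
  have h2 := congrArg Prod.snd (congrFun h t)
  have hq₁ := hf₁.q_pos t
  have hq₂ := hf₂.q_pos t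
  simp only at h2
  rw [div_eq_div_iff (by linarith) (by linarith)] at h2
  linarith

end IsFlow
/-! ### The scalar field along the planar system -/

/-- The scalar field of a solution of the planar system. -/
noncomputable def flowScalar (H q : ℝ → ℝ) (t : ℝ) : ℝ :=
  (1 - q t) / (4 * Real.sqrt 3 * H t ^ 2 * Real.sqrt (q t))

/-- The derivative of the scalar field of a solution of the planar system. -/
noncomputable def flowScalarDeriv (H q : ℝ → ℝ) (t : ℝ) : ℝ :=
  Real.sqrt 3 * H t * Real.sqrt (q t)

/-- The logarithmic derivative of `φ̇`. -/
noncomputable def scalarRate (h q : ℝ) : ℝ :=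
  -(h * ((5 * q + 1) * (3 * q - 1) - 12 * h ^ 2 * q * (q - 1))) / (1 - 2 * q + 5 * q ^ 2)

theorem continuous_of_hasDerivAt {f f' : ℝ → ℝ} (hf : ∀ t, HasDerivAt f (f' t) t) :
    Continuous f :=
  continuous_iff_continuousAt.2 fun t => (hf t).continuousAt

theorem contDiff_two_of_hasDerivAt {f f' f'' : ℝ → ℝ} (hf : ∀ t, HasDerivAt f (f' t) t)
    (hf' : ∀ t, HasDerivAt f' (f'' t) t) (hc : Continuous f'') : ContDiff ℝ 2 f := by
  have e : deriv f = f' := funext fun t => (hf t).deriv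
  have e' : deriv f' = f'' := funext fun t => (hf' t).deriv
  have h1 : ContDiff ℝ 1 f' :=
    contDiff_one_iff_deriv.2 ⟨fun t => (hf' t).differentiableAt, by rwa [e']⟩
  have h2 : ContDiff ℝ (1 + 1) f :=
    contDiff_succ_iff_deriv.2 ⟨fun t => (hf t).differentiableAt, by simp, by rwa [e]⟩
  simpa [one_add_one_eq_two] using h2

namespace IsFlow

variable {β : ℝ} {H q : ℝ → ℝ}

theorem sqrt_q_pos (hf : IsFlow β H H q) (t : ℝ) : 0 < Real.sqrt (q t) :=
  Real.sqrt_pos.2 (hf.q_pos t)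

theorem scalarDeriv_pos (hf : IsFlow β H H q) (t : ℝ) : 0 < flowScalarDeriv H q t := by
  have := hf.sqrt_q_pos t
  have := hf.H_pos t
  unfold flowScalarDeriv
  positivity

theorem scalarDeriv_sq (hf : IsFlow β H H q) (t : ℝ) :
    flowScalarDeriv H q t ^ 2 = 3 * H t ^ 2 * q t := by
  rw [flowScalarDeriv, mul_pow, mul_pow, Real.sq_sqrt (hf.q_pos t).le,
    Real.sq_sqrt (by norm_num)]

theorem scalar_mul_deriv (hf : IsFlow β H H q) (t : ℝ) :
    4 * H t * flowScalar H q t * flowScalarDeriv H q t = 1 - q t := by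
  have h1 := (hf.sqrt_q_pos t).ne'
  have h2 := (hf.H_pos t).ne'
  simp only [flowScalar, flowScalarDeriv]
  field_simp

theorem hasDerivAt_scalarDeriv (hf : IsFlow β H H q) (t : ℝ) :
    HasDerivAt (flowScalarDeriv H q)
      (flowScalarDeriv H q t * scalarRate (H t) (q t)) t := by
  have hs := hf.sqrt_q_pos t
  have hE := (quad_pos (q t)).ne'
  have hq : Real.sqrt (q t) ^ 2 = q t := Real.sq_sqrt (hf.q_pos t).le
  have h := ((hf.hasDerivAt_H t).const_mul (Real.sqrt 3)).fun_mul
    ((hf.hasDerivAt_q t).sqrt (hf.q_pos t).ne')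
  refine h.congr_deriv ?_
  have hsne := hs.ne'
  simp only [flowScalarDeriv, speedH, speedQ, scalarRate]
  generalize Real.sqrt (q t) = s at *
  rw [← hq] at hE ⊢
  field_simp
  ring

/-- The scalar field is defined algebraically, by solving the Friedmann constraint. That its
derivative is the prescribed `φ̇` expresses that the flow propagates this constraint. -/
theorem hasDerivAt_scalar (hf : IsFlow β H H q) (t : ℝ) :
    HasDerivAt (flowScalar H q) (flowScalarDeriv H q t) t := by
  have hs := hf.sqrt_q_pos t
  have hH := (hf.H_pos t).ne'
  have hE := (quad_pos (q t)).ne'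
  have hq : Real.sqrt (q t) ^ 2 = q t := Real.sq_sqrt (hf.q_pos t).le
  have h3 : Real.sqrt 3 ^ 2 = 3 := Real.sq_sqrt (by norm_num)
  have h3' : Real.sqrt 3 ≠ 0 := by positivity
  have hden : 4 * Real.sqrt 3 * H t ^ 2 * Real.sqrt (q t) ≠ 0 := by positivity
  have h := ((hf.hasDerivAt_q t).const_sub 1).fun_div
    ((((hf.hasDerivAt_H t).fun_pow 2).const_mul (4 * Real.sqrt 3)).fun_mul
    ((hf.hasDerivAt_q t).sqrt (hf.q_pos t).ne')) hden
  refine h.congr_deriv ?_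
  have hsne := hs.ne'
  simp only [flowScalarDeriv, speedH, speedQ]
  generalize Real.sqrt (q t) = s at *
  generalize Real.sqrt 3 = r at *
  rw [← hq] at hE ⊢
  -- The denominator is kept as an atom while fractions are cleared and expanded only for the final
  -- polynomial identity.
  obtain ⟨E, hEd⟩ : ∃ E, E = 1 - 2 * s ^ 2 + 5 * (s ^ 2) ^ 2 := ⟨_, rfl⟩
  rw [← hEd] at hE ⊢
  field_simp
  rw [h3, hEd]
  ring

theorem scalar_zero (hf : IsFlow β H H q) : flowScalar H q 0 = 0 := by
  simp [flowScalar, hf.q_init]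

theorem scalarDeriv_zero (hf : IsFlow β H H q) : flowScalarDeriv H q 0 = Real.sqrt 3 * β := by
  simp [flowScalarDeriv, hf.q_init, hf.H_init]

theorem continuous_H (hf : IsFlow β H H q) : Continuous H :=
  continuous_of_hasDerivAt hf.hasDerivAt_H

theorem continuous_q (hf : IsFlow β H H q) : Continuous q :=
  continuous_of_hasDerivAt hf.hasDerivAt_q

/-- The pair `(a, φ)` belonging to a solution of the planar system. -/
theorem isGlobalSolution (hf : IsFlow β H H q) {a₀ : ℝ} (ha₀ : 0 < a₀) :
    IsGlobalSolution a₀ β (fun t => a₀ * Real.exp (∫ s in (0 : ℝ)..t, H s))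
      (flowScalar H q) := by
  set a : ℝ → ℝ := fun t => a₀ * Real.exp (∫ s in (0 : ℝ)..t, H s) with ha
  have hapos : ∀ t, 0 < a t := fun t => mul_pos ha₀ (Real.exp_pos _)
  have hda : ∀ t, HasDerivAt a (a t * H t) t := by
    intro t
    have := ((hf.continuous_H.integral_hasStrictDerivAt 0 t).hasDerivAt.exp).const_mul a₀
    exact this.congr_deriv (by rw [ha]; ring)
  have hub : hubble a = H := by
    ext t
    rw [hubble, (hda t).deriv, mul_div_cancel_left₀ _ (hapos t).ne']
  have hcH := hf.continuous_H
  have hcq := hf.continuous_q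
  have hca := continuous_of_hasDerivAt hda
  have hcψ := continuous_of_hasDerivAt hf.hasDerivAt_scalarDeriv
  have hE := fun t => (quad_pos (q t)).ne'
  have hcsp : Continuous fun t => speedH (H t) (q t) := by
    unfold speedH
    exact Continuous.div (by fun_prop) (by fun_prop) hE
  have hcrate : Continuous fun t => scalarRate (H t) (q t) := by
    unfold scalarRate
    exact Continuous.div (by fun_prop) (by fun_prop) hE
  have hflrw : IsFLRW a (flowScalar H q) :=
    ⟨contDiff_two_of_hasDerivAt hda (fun t => (hda t).fun_mul (hf.hasDerivAt_H t))
      (by fun_prop), contDiff_two_of_hasDerivAt hf.hasDerivAt_scalar hf.hasDerivAt_scalarDeriv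
      (by fun_prop), hapos⟩
  have hd1 : deriv (flowScalar H q) = flowScalarDeriv H q :=
    funext fun t => (hf.hasDerivAt_scalar t).deriv
  refine ⟨hflrw, (fieldEquations_iff_reducedSystem hflrw).2 ⟨fun t => ?_, fun t => ?_, fun t => ?_⟩,
    by simp [ha], by rw [hub, hf.H_init], hf.scalar_zero,
    by rw [hd1]; exact hf.scalarDeriv_pos 0⟩
  all_goals
    rw [hub, hd1]
    have hH := hf.H_pos t
    have hψ := hf.scalarDeriv_pos t
    have h1 := hf.scalarDeriv_sq t
    have h2 := hf.scalar_mul_deriv t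
    -- The equations are arranged to contain `φ` only through `φφ̇` and `φ̇` otherwise only squared,
    -- so no square roots remain.
    have hP : flowScalar H q t * flowScalarDeriv H q t = (1 - q t) / (4 * H t) := by
      rw [eq_div_iff (by positivity)]; linarith
  · linear_combination -h1 - 3 * H t ^ 2 * h2
  · rw [(hf.hasDerivAt_H t).deriv, (hf.hasDerivAt_scalarDeriv t).deriv]
    have e : -flowScalarDeriv H q t ^ 2 + 8 * (speedH (H t) (q t) + H t ^ 2) * H t
        * flowScalar H q t * flowScalarDeriv H q t + 4 * H t ^ 2 * (flowScalarDeriv H q t ^ 2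
        + flowScalar H q t * (flowScalarDeriv H q t * scalarRate (H t) (q t))) =
        -flowScalarDeriv H q t ^ 2 + 8 * (speedH (H t) (q t) + H t ^ 2) * H t
        * (flowScalar H q t * flowScalarDeriv H q t) + 4 * H t ^ 2 * (flowScalarDeriv H q t ^ 2
        + (flowScalar H q t * flowScalarDeriv H q t) * scalarRate (H t) (q t)) := by ring
    have hEt := hE t
    rw [e, hP, h1, speedH, scalarRate]
    obtain ⟨E, hEd⟩ : ∃ E, E = 1 - 2 * q t + 5 * q t ^ 2 := ⟨_, rfl⟩
    rw [← hEd] at hEt ⊢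
    field_simp
    rw [hEd]
    ring
  · rw [(hf.hasDerivAt_H t).deriv, (hf.hasDerivAt_scalarDeriv t).deriv]
    refine (mul_eq_zero.1 (?_ : flowScalarDeriv H q t * _ = 0)).resolve_left hψ.ne'
    have e : flowScalarDeriv H q t * (flowScalarDeriv H q t * scalarRate (H t) (q t)
        + 3 * flowScalarDeriv H q t * H t
        + 6 * flowScalar H q t * (H t ^ 2 + speedH (H t) (q t)) * H t ^ 2) =
        flowScalarDeriv H q t ^ 2 * (scalarRate (H t) (q t) + 3 * H t)
        + 6 * (flowScalar H q t * flowScalarDeriv H q t)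
          * (H t ^ 2 + speedH (H t) (q t)) * H t ^ 2 := by ring
    have hEt := hE t
    rw [e, hP, h1, speedH, scalarRate]
    obtain ⟨E, hEd⟩ : ∃ E, E = 1 - 2 * q t + 5 * q t ^ 2 := ⟨_, rfl⟩
    rw [← hEd] at hEt ⊢
    field_simp
    rw [hEd]
    ring

end IsFlow

/-! ### The planar system of a solution of the field equations -/

/-- The reduced system is linear in `Ḣ` and `φ̈` with positive determinant. Friedmann makes `Ḣ` a
continuous multiple of `H`, so `H` keeps its sign. Then `φ̇` cannot vanish, again by Friedmann, and
`q` is well defined and positive. -/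
theorem IsGlobalSolution.exists_isFlow {a₀ β : ℝ} {a φ : ℝ → ℝ}
    (h : IsGlobalSolution a₀ β a φ) (hβ : 0 < β) :
    ∃ q, IsFlow β (hubble a) (hubble a) q ∧ φ = flowScalar (hubble a) q ∧
      deriv φ = flowScalarDeriv (hubble a) q := by
  obtain ⟨hC, hφC, ha⟩ := h.isFLRW
  obtain ⟨c1, c2, c3⟩ := (fieldEquations_iff_reducedSystem h.isFLRW).1 h.field_eq
  have dH : ∀ t, HasDerivAt (hubble a) (deriv (hubble a) t) t := fun t =>
    (hasDerivAt_hubble hC ha t).differentiableAt.hasDerivAt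
  have dφ := hasDerivAt_of_C2 hφC
  have dψ := hasDerivAt_deriv hφC
  have cH := continuous_of_hasDerivAt dH
  have cφ := continuous_of_hasDerivAt dφ
  have cψ := continuous_of_hasDerivAt dψ
  have hH0 := h.hubble_init
  have hφ0 := h.scalar_init
  have hψ0 := h.scalar_deriv_init
  set H := hubble a
  set ψ := deriv φ
  -- Determinant of the linear system for `(Ḣ, φ̈)`. By Friedmann, `H²` times it is a sum of
  -- squares; where `H = 0` it equals `2`.
  have hD : ∀ t, 0 < 2 - 8 * H t * φ t * ψ t + 24 * H t ^ 4 * φ t ^ 2 := by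
    intro t
    by_cases hz : H t = 0
    · simp [hz]
    · have hψ : ψ t ≠ 0 := by
        intro h0
        have := c1 t
        rw [h0] at this
        simp at this
        exact hz this
      have h2 : 0 < H t ^ 2 := by positivity
      have h3 : 0 < ψ t ^ 2 := by positivity
      refine pos_of_mul_pos_right (a := H t ^ 2) ?_ h2.le
      have : H t ^ 2 * (2 - 8 * H t * φ t * ψ t + 24 * H t ^ 4 * φ t ^ 2)
          = 2 / 3 * ψ t ^ 2 + 24 * (H t ^ 3 * φ t) ^ 2 := by
        linear_combination 2 / 3 * c1 t
      rw [this]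
      positivity
  have hDH : ∀ t, (2 - 8 * H t * φ t * ψ t + 24 * H t ^ 4 * φ t ^ 2) * deriv H t
      = -3 * H t ^ 2 - ψ t ^ 2 - 4 * H t ^ 3 * φ t * ψ t + 4 * H t ^ 2 * ψ t ^ 2
        - 24 * φ t ^ 2 * H t ^ 6 := by
    intro t
    linear_combination c2 t + 4 * H t ^ 2 * φ t * c3 t
  have hHpos : ∀ t, 0 < H t := by
    refine pos_of_abs_deriv_le dH (by rwa [hH0]) fun T _ => ?_
    have hcont : Continuous fun t => (-6 * H t + 8 * H t ^ 2 * φ t * ψ t + 4 * H t * ψ t ^ 2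
        - 24 * φ t ^ 2 * H t ^ 5) / (2 - 8 * H t * φ t * ψ t + 24 * H t ^ 4 * φ t ^ 2) :=
      Continuous.div (by fun_prop) (by fun_prop) fun t => (hD t).ne'
    obtain ⟨C, hC⟩ := (isCompact_Icc (a := -T) (b := T)).exists_bound_of_continuousOn
      hcont.continuousOn
    refine ⟨C, fun t ht => ?_⟩
    -- Replacing the isolated `ψ²` through Friedmann gives every term of the right side of `hDH` a
    -- factor `H`.
    have e : deriv H t = (-6 * H t + 8 * H t ^ 2 * φ t * ψ t + 4 * H t * ψ t ^ 2
        - 24 * φ t ^ 2 * H t ^ 5) / (2 - 8 * H t * φ t * ψ t + 24 * H t ^ 4 * φ t ^ 2)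
        * H t := by
      rw [div_mul_eq_mul_div, eq_div_iff (hD t).ne', mul_comm, hDH]
      linear_combination c1 t
    rw [e, abs_mul]
    exact mul_le_mul_of_nonneg_right (hC t ht) (abs_nonneg _)
  have hψpos : ∀ t, 0 < ψ t := by
    refine pos_of_ne_zero cψ hψ0 fun t h0 => ?_
    have := c1 t
    rw [h0] at this
    simp at this
    exact (hHpos t).ne' this
  set q : ℝ → ℝ := fun t => ψ t ^ 2 / (3 * H t ^ 2) with hq
  have hψq : ∀ t, ψ t ^ 2 = 3 * H t ^ 2 * q t := by
    intro t
    have := (hHpos t).ne'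
    simp only [hq]
    field_simp
  have hP : ∀ t, 4 * H t * φ t * ψ t = 1 - q t := by
    intro t
    have := (hHpos t).ne'
    refine mul_left_cancel₀ (pow_ne_zero 2 this) ?_
    linear_combination (-c1 t - hψq t) / 3
  have hqpos : ∀ t, 0 < q t := by
    intro t
    have := hHpos t
    have := hψpos t
    simp only [hq]
    positivity
  have hHspeed : ∀ t, deriv H t = speedH (H t) (q t) := by
    intro t
    rw [speedH, eq_div_iff (quad_pos (q t)).ne']
    -- The square of `hP`. With it, `2q` times the determinant becomes `1 - 2q + 5q²`.
    have hφ2 : 48 * H t ^ 4 * q t * φ t ^ 2 = (1 - q t) ^ 2 := by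
      linear_combination (4 * H t * φ t * ψ t + (1 - q t)) * hP t
        - 16 * H t ^ 2 * φ t ^ 2 * hψq t
    linear_combination 2 * q t * hDH t + (4 * q t * hP t - hφ2) * deriv H t
      + (8 * H t ^ 2 * q t - 2 * q t) * hψq t - 2 * q t * H t ^ 2 * hP t - H t ^ 2 * hφ2
  refine ⟨q, ⟨hHpos, fun _ _ => rfl, hqpos, fun t => hHspeed t ▸ dH t, fun t => ?_, hH0, ?_⟩,
    ?_, ?_⟩
  · have hHt := (hHpos t).ne'
    have h1 := ((dψ t).fun_pow 2).fun_div (((dH t).fun_pow 2).const_mul 3)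
      (by positivity : 3 * H t ^ 2 ≠ 0)
    refine h1.congr_deriv ?_
    have hψψ : ψ t * deriv ψ t = -9 * H t ^ 3 * q t
        - 3 / 2 * (1 - q t) * H t * (H t ^ 2 + deriv H t) := by
      linear_combination ψ t * c3 t - 3 * H t * hψq t
        - 3 / 2 * H t * (H t ^ 2 + deriv H t) * hP t
    have e : ((2 : ℕ) * ψ t ^ (2 - 1) * deriv ψ t * (3 * H t ^ 2)
        - ψ t ^ 2 * (3 * ((2 : ℕ) * H t ^ (2 - 1) * deriv H t))) / (3 * H t ^ 2) ^ 2
        = 2 * (ψ t * deriv ψ t) / (3 * H t ^ 2) - 2 * q t * deriv H t / H t := by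
      rw [hψq]
      field_simp
      ring
    rw [e, hψψ, hHspeed, speedH, speedQ]
    have hE := (quad_pos (q t)).ne'
    obtain ⟨E, hEd⟩ : ∃ E, E = 1 - 2 * q t + 5 * q t ^ 2 := ⟨_, rfl⟩
    rw [← hEd] at hE ⊢
    field_simp
    rw [hEd]
    ring
  · have := c1 0
    rw [hφ0] at this
    simp only [hq]
    rw [hH0] at this ⊢
    rw [div_eq_one_iff_eq (by positivity)]
    linarith
  all_goals
    have hs : ∀ t, Real.sqrt (q t) = ψ t / (Real.sqrt 3 * H t) := by
      intro t
      simp only [hq]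
      rw [Real.sqrt_div (sq_nonneg _), Real.sqrt_mul (by norm_num), Real.sqrt_sq (hψpos t).le,
        Real.sqrt_sq (hHpos t).le]
    ext t
    have h1 := (hHpos t).ne'
    have h2 := (hψpos t).ne'
    have h3 : Real.sqrt 3 ≠ 0 := by positivity
  · rw [flowScalar, hs, ← hP t]
    field_simp
  · rw [flowScalarDeriv, hs]
    field_simp

/-! ### Existence and uniqueness of the global pair. -/

theorem hasDerivAt_log_scale {a φ : ℝ → ℝ} (h : IsFLRW a φ) (t : ℝ) :
    HasDerivAt (fun t => Real.log (a t)) (hubble a t) t :=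
  (hasDerivAt_of_C2 h.scale_C2 t).log (h.scale_pos t).ne'

theorem existsUnique_isGlobalSolution {a₀ β : ℝ} (ha₀ : 0 < a₀) (h0 : 0 < β)
    (hβ : β ^ 2 < 1 / 3) :
    ∃! p : (ℝ → ℝ) × (ℝ → ℝ), IsGlobalSolution a₀ β p.1 p.2 := by
  obtain ⟨H, q, hf⟩ := ESGB.exists_isFlow h0 hβ
  have hex := hf.isGlobalSolution ha₀
  refine ⟨(_, _), hex, ?_⟩
  have huniq : ∀ a₁ φ₁ a₂ φ₂, IsGlobalSolution a₀ β a₁ φ₁ → IsGlobalSolution a₀ β a₂ φ₂ →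
      a₁ = a₂ ∧ φ₁ = φ₂ := by
    intro a₁ φ₁ a₂ φ₂ h₁ h₂
    obtain ⟨q₁, f₁, e₁, -⟩ := h₁.exists_isFlow h0
    obtain ⟨q₂, f₂, e₂, -⟩ := h₂.exists_isFlow h0
    obtain ⟨eH, eq⟩ := f₁.unique f₂ h0 hβ
    refine ⟨?_, by rw [e₁, e₂, eH, eq]⟩
    -- Equal Hubble parameters determine the scale factor up to a constant, fixed by `a(0) = a₀`.
    have hd : ∀ t, HasDerivAt (fun t => Real.log (a₁ t) - Real.log (a₂ t)) 0 t := by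
      intro t
      have := (hasDerivAt_log_scale h₁.isFLRW t).fun_sub (hasDerivAt_log_scale h₂.isFLRW t)
      rwa [eH, sub_self] at this
    ext t
    have hc := is_const_of_deriv_eq_zero (fun t => (hd t).differentiableAt)
      (fun t => (hd t).deriv) t 0
    simp only [h₁.scale_init, h₂.scale_init, sub_self] at hc
    exact Real.log_injOn_pos (h₁.isFLRW.scale_pos t) (h₂.isFLRW.scale_pos t) (sub_eq_zero.1 hc)
  rintro ⟨a, φ⟩ h
  obtain ⟨e1, e2⟩ := huniq _ _ _ _ h hex
  exact Prod.ext e1 e2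

/-! ### Bounds in the future -/

theorem hasDerivAt_exp_mul (c t : ℝ) :
    HasDerivAt (fun t => Real.exp (c * t)) (c * Real.exp (c * t)) t := by
  have := ((hasDerivAt_id t).const_mul c).exp
  simp only [id, mul_one] at this
  rwa [mul_comm] at this

theorem hasDerivAt_log_affine {c t : ℝ} (h : 0 < c * t + 1) :
    HasDerivAt (fun t => Real.log (c * t + 1)) (c / (c * t + 1)) t := by
  have := (((hasDerivAt_id t).const_mul c).add_const 1).log (by simpa using h.ne')
  simpa using this

theorem one_div_affine {β c t : ℝ} (hβ : 0 < β) :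
    1 / (c * t + 1 / β) = β / (c * β * t + 1) := by
  rw [show c * t + 1 / β = (c * β * t + 1) / β by field_simp, one_div_div]

namespace IsFlow

variable {β : ℝ} {H q : ℝ → ℝ}

theorem H_le_init (hf : IsFlow β H H q) (h0 : 0 < β) (hβ : β ^ 2 < 1 / 3) {t : ℝ}
    (ht : 0 ≤ t) : H t ≤ β := by
  rcases ht.lt_or_eq with h | rfl
  · refine (hf.H_lt_future h0 hβ h).le.trans ?_
    rw [div_le_iff₀ (by positivity)]
    have : β * (1 / β) = 1 := by field_simp
    nlinarith
  · exact hf.H_init.le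

theorem lt_H_future (hf : IsFlow β H H q) (h0 : 0 < β) {t : ℝ} (ht : 0 < t) :
    1 / (5 * t + 1 / β) < H t := by
  have := neg_of_deriv_neg_of_zero (f := fun t => 1 / (5 * t + 1 / β) - H t)
    (fun t ht => (hasDerivAt_future_barrier h0 (by norm_num) ht).fun_sub (hf.hasDerivAt_H t))
    (by simp [hf.H_init])
    (fun t ht h1 => by
      rw [sub_eq_zero.1 h1]
      linarith [neg_five_lt_speedH (hf.H_pos t) (hf.q_pos t)]) ht
  linarith

theorem scalarDeriv_lt_future (hf : IsFlow β H H q) (h0 : 0 < β) (hβ : β ^ 2 < 1 / 3) {t : ℝ}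
    (ht : 0 < t) : flowScalarDeriv H q t < Real.sqrt 3 / (t + 1 / β) := by
  have hs : Real.sqrt (q t) < 1 := (Real.sqrt_lt' one_pos).2 (by simpa using hf.q_lt_one ht)
  have h3 : 0 < Real.sqrt 3 * H t := mul_pos (by positivity) (hf.H_pos t)
  have h := mul_lt_mul_of_pos_left (hf.H_lt_future h0 hβ ht) (by positivity : 0 < Real.sqrt 3)
  rw [mul_one_div] at h
  refine lt_trans ?_ h
  rw [flowScalarDeriv]
  nlinarith

theorem scalar_lt_future (hf : IsFlow β H H q) (h0 : 0 < β) (hβ : β ^ 2 < 1 / 3) {t : ℝ}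
    (ht : 0 < t) : flowScalar H q t < Real.sqrt 3 * Real.log (β * t + 1) := by
  have := lt_of_deriv_pos_right
    (f := fun t => Real.sqrt 3 * Real.log (β * t + 1) - flowScalar H q t)
    (fun t ht => ((hasDerivAt_log_affine (by positivity : 0 < β * t + 1)).const_mul
      (Real.sqrt 3)).fun_sub (hf.hasDerivAt_scalar t))
    (fun t ht => by
      have h1 := hf.scalarDeriv_lt_future h0 hβ ht
      have h2 := one_div_affine (c := 1) (t := t) h0
      rw [one_mul, one_mul] at h2
      rw [← h2, mul_one_div]
      linarith) ht
  simp only [mul_zero, zero_add, Real.log_one, hf.scalar_zero, sub_zero] at this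
  linarith

theorem scalar_pos_future (hf : IsFlow β H H q) {t : ℝ} (ht : 0 < t) :
    0 < flowScalar H q t := by
  have h1 := sub_pos.2 (hf.q_lt_one ht)
  have h2 := hf.H_pos t
  have h3 := hf.sqrt_q_pos t
  unfold flowScalar
  positivity

/-- The quantity `√q / H²` starts at `1/β²` and increases, as its logarithmic derivative has the
sign of `1 - 3H²q`. -/
theorem H_sq_lt_future (hf : IsFlow β H H q) (h0 : 0 < β) (hβ : β ^ 2 < 1 / 3) {t : ℝ}
    (ht : 0 < t) : H t ^ 2 < β ^ 2 * Real.sqrt (q t) := by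
  have := lt_of_deriv_pos_right
    (f := fun t => 1 / 2 * Real.log (q t) - 2 * Real.log (H t))
    (fun t _ => (((hf.hasDerivAt_q t).log (hf.q_pos t).ne').const_mul (1 / 2)).fun_sub
      (((hf.hasDerivAt_H t).log (hf.H_pos t).ne').const_mul 2))
    (fun t ht => by
      have hH := hf.H_pos t
      have hq := hf.q_pos t
      have hE := quad_pos (q t)
      have hX : 0 < 1 - 3 * H t ^ 2 * q t := by
        have h1 := hf.H_le_init h0 hβ ht.le
        have h2 := hf.q_lt_one ht
        have : H t ^ 2 ≤ β ^ 2 := by gcongr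
        nlinarith [sq_nonneg (H t)]
      have e : 1 / 2 * (speedQ (H t) (q t) / q t) - 2 * (speedH (H t) (q t) / H t) =
          4 * H t * (5 * q t + 1) * (1 - 3 * H t ^ 2 * q t) / (1 - 2 * q t + 5 * q t ^ 2) := by
        rw [speedQ, speedH]
        have hE' := hE.ne'
        field_simp
        ring
      rw [e]
      positivity) ht
  simp only [hf.q_init, hf.H_init, Real.log_one] at this
  have hH := hf.H_pos t
  have hs := hf.sqrt_q_pos t
  rw [← Real.log_lt_log_iff (by positivity) (by positivity),
    Real.log_mul (by positivity) (by positivity), Real.log_sqrt (hf.q_pos t).le,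
    Real.log_pow, Real.log_pow]
  push_cast
  linarith

theorem one_sub_q_eq (hf : IsFlow β H H q) (t : ℝ) :
    1 - q t = 4 * Real.sqrt 3 * H t ^ 2 * flowScalar H q t * Real.sqrt (q t) := by
  rw [← hf.scalar_mul_deriv t, flowScalarDeriv]
  ring

/-- Insert `φ < √3 log(βt + 1)` and `H² < β²√q` into `1 - q = 4√3 H²φ√q`. This bounds `q` below by
`1 / (1 + 12β² log(βt + 1))`; multiply `√q` by the lower bound for `√3 H`. -/
theorem lt_scalarDeriv_future (hf : IsFlow β H H q) (h0 : 0 < β) (hβ : β ^ 2 < 1 / 3) {t : ℝ}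
    (ht : 0 < t) :
    1 / Real.sqrt (1 + 12 * β ^ 2 * Real.log (β * t + 1))
      * (Real.sqrt 3 / (5 * t + 1 / β)) < flowScalarDeriv H q t := by
  have hL : 0 < Real.log (β * t + 1) := Real.log_pos (by nlinarith)
  have hs := hf.sqrt_q_pos t
  have hφ := hf.scalar_lt_future h0 hβ ht
  have hW := hf.H_sq_lt_future h0 hβ ht
  have h3 : Real.sqrt 3 * Real.sqrt 3 = 3 := Real.mul_self_sqrt (by norm_num)
  have h3' : 0 < Real.sqrt 3 := by positivity
  have hH := hf.H_pos t
  have hA : 0 < 1 + 12 * β ^ 2 * Real.log (β * t + 1) := by positivity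
  have hqA : 1 < q t * (1 + 12 * β ^ 2 * Real.log (β * t + 1)) := by
    have h1 : 4 * Real.sqrt 3 * H t ^ 2 * flowScalar H q t * Real.sqrt (q t)
        < 4 * Real.sqrt 3 * H t ^ 2 * (Real.sqrt 3 * Real.log (β * t + 1)) * Real.sqrt (q t) := by
      gcongr
    have h2 : 12 * Real.log (β * t + 1) * Real.sqrt (q t) * H t ^ 2 <
        12 * Real.log (β * t + 1) * Real.sqrt (q t) * (β ^ 2 * Real.sqrt (q t)) := by
      gcongr
    have h4 := Real.sq_sqrt (hf.q_pos t).le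
    rw [← hf.one_sub_q_eq t] at h1
    have e1 : 4 * Real.sqrt 3 * H t ^ 2 * (Real.sqrt 3 * Real.log (β * t + 1)) * Real.sqrt (q t)
        = 12 * Real.log (β * t + 1) * Real.sqrt (q t) * H t ^ 2 := by
      linear_combination 4 * H t ^ 2 * Real.log (β * t + 1) * Real.sqrt (q t) * h3
    have e2 : 12 * Real.log (β * t + 1) * Real.sqrt (q t) * (β ^ 2 * Real.sqrt (q t))
        = q t * (12 * β ^ 2 * Real.log (β * t + 1)) := by
      linear_combination 12 * β ^ 2 * Real.log (β * t + 1) * h4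
    linarith
  have h5 : 1 / Real.sqrt (1 + 12 * β ^ 2 * Real.log (β * t + 1)) < Real.sqrt (q t) := by
    rw [div_lt_iff₀ (by positivity), ← Real.sqrt_mul (hf.q_pos t).le]
    exact Real.lt_sqrt_of_sq_lt (by simpa using hqA)
  have h6 : Real.sqrt 3 / (5 * t + 1 / β) < Real.sqrt 3 * H t := by
    rw [← mul_one_div]
    exact mul_lt_mul_of_pos_left (hf.lt_H_future h0 ht) h3'
  rw [flowScalarDeriv, mul_comm (Real.sqrt 3 * H t)]
  exact mul_lt_mul'' h5 h6 (by positivity) (by positivity)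

/-- The quadratic `6β²φ² + √3 φ` has derivative `3H(4√3 β²φ√q + √q)`. This is at least `3H(1 - q +
√q) ≥ 3H > 3β/(5βt + 1)`. Integration and solving the quadratic inequality give the bound. -/
theorem lt_scalar_future (hf : IsFlow β H H q) (h0 : 0 < β) (hβ : β ^ 2 < 1 / 3) {t : ℝ}
    (ht : 0 < t) :
    (-1 + Real.sqrt (1 + 24 * β ^ 2 / 5 * Real.log (1 + 5 * β * t)))
      / (4 * Real.sqrt 3 * β ^ 2) < flowScalar H q t := by
  have h3 : Real.sqrt 3 ^ 2 = 3 := Real.sq_sqrt (by norm_num)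
  have h3' : 0 < Real.sqrt 3 := by positivity
  have key := lt_of_deriv_pos_right
    (f := fun t => 6 * β ^ 2 * flowScalar H q t ^ 2 + Real.sqrt 3 * flowScalar H q t
      - 3 / 5 * Real.log (5 * β * t + 1))
    (fun t ht => ((((hf.hasDerivAt_scalar t).fun_pow 2).const_mul (6 * β ^ 2)).fun_add
      ((hf.hasDerivAt_scalar t).const_mul (Real.sqrt 3))).fun_sub
      ((hasDerivAt_log_affine (by positivity : 0 < 5 * β * t + 1)).const_mul (3 / 5)))
    (fun t ht => by
      have hφ := hf.scalar_pos_future ht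
      have hs := hf.sqrt_q_pos t
      have hH := hf.H_pos t
      have hHβ := hf.H_le_init h0 hβ ht.le
      have hlow := hf.lt_H_future h0 ht
      rw [one_div_affine h0] at hlow
      have hs1 : Real.sqrt (q t) < 1 :=
        (Real.sqrt_lt' one_pos).2 (by simpa using hf.q_lt_one ht)
      have hqs : q t ≤ Real.sqrt (q t) := by
        nlinarith [Real.sq_sqrt (hf.q_pos t).le]
      have h1 := hf.one_sub_q_eq t
      have h2 : 4 * Real.sqrt 3 * H t ^ 2 * flowScalar H q t * Real.sqrt (q t)
          ≤ 4 * Real.sqrt 3 * β ^ 2 * flowScalar H q t * Real.sqrt (q t) := by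
        gcongr
      have h4 : H t * 1 ≤ H t * (4 * Real.sqrt 3 * β ^ 2 * flowScalar H q t * Real.sqrt (q t)
          + Real.sqrt (q t)) := mul_le_mul_of_nonneg_left (by linarith) hH.le
      have e : 6 * β ^ 2 * ((2 : ℕ) * flowScalar H q t ^ (2 - 1) * flowScalarDeriv H q t)
          + Real.sqrt 3 * flowScalarDeriv H q t =
          3 * (H t * (4 * Real.sqrt 3 * β ^ 2 * flowScalar H q t * Real.sqrt (q t)
          + Real.sqrt (q t))) := by
        rw [flowScalarDeriv]
        push_cast
        simp only [pow_one]
        linear_combination H t * Real.sqrt (q t) * h3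
      rw [e, show 3 / 5 * (5 * β / (5 * β * t + 1)) = 3 * (β / (5 * β * t + 1)) by ring]
      linarith) ht
  simp only [hf.scalar_zero, mul_zero, zero_add, Real.log_one] at key
  rw [add_comm 1 (5 * β * t), div_lt_iff₀ (by positivity)]
  have hφ := hf.scalar_pos_future ht
  have : Real.sqrt (1 + 24 * β ^ 2 / 5 * Real.log (5 * β * t + 1))
      < 1 + flowScalar H q t * (4 * Real.sqrt 3 * β ^ 2) := by
    rw [Real.sqrt_lt' (by positivity)]
    have h4 : 0 < 8 * β ^ 2 := by positivity
    -- Completing the square in the quadratic that `key` bounds.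
    have e : (1 + flowScalar H q t * (4 * Real.sqrt 3 * β ^ 2)) ^ 2 =
        1 + 8 * β ^ 2 * (6 * β ^ 2 * flowScalar H q t ^ 2 + Real.sqrt 3 * flowScalar H q t) := by
      linear_combination 16 * flowScalar H q t ^ 2 * β ^ 4 * h3
    rw [e]
    nlinarith
  linarith

end IsFlow

theorem IsGlobalSolution.futureBounds {a₀ β : ℝ} {a φ : ℝ → ℝ} (h : IsGlobalSolution a₀ β a φ)
    (ha₀ : 0 < a₀) (h0 : 0 < β) (hβ : β ^ 2 < 1 / 3) {t : ℝ} (ht : 0 < t) :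
    FutureBounds a₀ β a φ t := by
  obtain ⟨q, hf, e1, e2⟩ := h.exists_isFlow h0
  have hat := h.isFLRW.scale_pos t
  have hlog := fun t => hasDerivAt_log_scale h.isFLRW t
  refine ⟨?_, ?_, hf.lt_H_future h0 ht, hf.H_lt_future h0 hβ ht, ?_, ?_, ?_, ?_⟩
  · rw [e1]; exact hf.lt_scalar_future h0 hβ ht
  · rw [e1]; exact hf.scalar_lt_future h0 hβ ht
  · rw [e2]; exact hf.lt_scalarDeriv_future h0 hβ ht
  · rw [e2]; exact hf.scalarDeriv_lt_future h0 hβ ht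
  · have := lt_of_deriv_pos_right
      (f := fun t => Real.log (a t) - 1 / 5 * Real.log (5 * β * t + 1))
      (fun t ht => (hlog t).fun_sub
        ((hasDerivAt_log_affine (by positivity : 0 < 5 * β * t + 1)).const_mul (1 / 5)))
      (fun t ht => by
        have hlow := hf.lt_H_future h0 ht
        rw [one_div_affine h0] at hlow
        rw [show 1 / 5 * (5 * β / (5 * β * t + 1)) = β / (5 * β * t + 1) by ring]
        linarith) ht
    simp only [h.scale_init, mul_zero, zero_add, Real.log_one] at this
    have hp : 0 < 5 * β * t + 1 := by positivity
    rw [← Real.log_lt_log_iff (by positivity) hat, Real.log_mul ha₀.ne' (by positivity),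
      Real.log_rpow hp]
    linarith
  · have := lt_of_deriv_pos_right
      (f := fun t => Real.log (β * t + 1) - Real.log (a t))
      (fun t ht => (hasDerivAt_log_affine (by positivity : 0 < β * t + 1)).fun_sub (hlog t))
      (fun t ht => by
        have hup := hf.H_lt_future h0 hβ ht
        have e := one_div_affine (c := 1) (t := t) h0
        rw [one_mul, one_mul] at e
        rw [e] at hup
        linarith) ht
    simp only [h.scale_init, mul_zero, zero_add, Real.log_one] at this
    have hp : 0 < β * t + 1 := by positivity
    rw [← Real.log_lt_log_iff hat (by positivity), Real.log_mul ha₀.ne' (by positivity)]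
    linarith

/-! ### Bounds in the past -/

theorem scalarRate_gt {h q : ℝ} (hh : 0 < h) (hh1 : h < 1) (hq : 1 ≤ q) :
    -12 < scalarRate h q := by
  rw [scalarRate, lt_div_iff₀ (quad_pos q)]
  have h1 : 0 ≤ h ^ 3 * q * (q - 1) := mul_nonneg (by positivity) (by linarith)
  have h2 : 0 ≤ (1 - h) * ((5 * q + 1) * (3 * q - 1)) :=
    mul_nonneg (by linarith) (mul_nonneg (by linarith) (by linarith))
  nlinarith [sq_nonneg (q - 1)]

/-- The constant `9/5 = (15 - 6)/5` is the ratio of leading coefficients in `q` at the extreme value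
`h² = 1/2`. -/
theorem scalarRate_lt {h q : ℝ} (hh : 0 < h) (hX : h ^ 2 < 1 / 2) (hq : 1 ≤ q) :
    scalarRate h q < -(9 / 5 * h) := by
  rw [scalarRate, div_lt_iff₀ (quad_pos q)]
  have h1 : 0 ≤ (1 - 2 * h ^ 2) * (q * (q - 1)) :=
    mul_nonneg (by linarith) (mul_nonneg (by linarith) (by linarith))
  have h2 : 0 < h * ((5 * q + 1) * (3 * q - 1) - 12 * h ^ 2 * q * (q - 1)
      - 9 / 5 * (1 - 2 * q + 5 * q ^ 2)) := mul_pos hh (by nlinarith)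
  linarith

/-! ### Logistic barriers below `H` in the past. -/

theorem sq_le_of_le_sqrt {β : ℝ} (h : β ≤ Real.sqrt (5 / 27)) (h0 : 0 < β) : β ^ 2 ≤ 5 / 27 :=
  (Real.le_sqrt h0.le (by norm_num)).1 h

theorem two_fifths_lt {β : ℝ} (h : Real.sqrt (5 / 27) < β) : 2 / 5 < β :=
  lt_trans (Real.lt_sqrt_of_sq_lt (by norm_num)) h

theorem boundH_zero {β : ℝ} (h0 : 0 < β) : boundH β 0 = β := by
  unfold boundH
  split_ifs
  · simp only [mul_zero, zero_div, Real.exp_zero]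
    field_simp
    norm_num
  · simp only [mul_zero, Real.exp_zero]
    rw [show 5 * β - (5 * β - 2) * 1 = 2 by ring]
    ring

theorem exp_mul_le_one {c t : ℝ} (hc : 0 ≤ c) (ht : t ≤ 0) : Real.exp (c * t) ≤ 1 :=
  Real.exp_le_one_iff.2 (mul_nonpos_of_nonneg_of_nonpos hc ht)

theorem exp_mul_lt_one {c t : ℝ} (hc : 0 < c) (ht : t < 0) : Real.exp (c * t) < 1 :=
  (Real.exp_lt_exp.2 (mul_neg_of_pos_of_neg hc ht)).trans_eq Real.exp_zero

theorem boundH_of_le {β : ℝ} (h : β ≤ Real.sqrt (5 / 27)) (t : ℝ) :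
    boundH β t = 227 * β / (2 * Real.exp (454 * β / 45 * t) + 225) := by
  rw [boundH, if_pos h, show 454 * β * t / 45 = 454 * β / 45 * t by ring]

theorem boundH_of_lt {β : ℝ} (h : Real.sqrt (5 / 27) < β) (t : ℝ) :
    boundH β t = 2 * β / (5 * β - (5 * β - 2) * Real.exp (4 * t)) := by
  rw [boundH, if_neg h.not_ge]

theorem boundH_large_denom {β t : ℝ} (h : 2 / 5 < β) (ht : t ≤ 0) :
    2 ≤ 5 * β - (5 * β - 2) * Real.exp (4 * t) := by
  have := exp_mul_le_one (c := 4) (by norm_num) ht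
  nlinarith

theorem hasDerivAt_boundH_of_le {β : ℝ} (h0 : 0 < β) (h : β ≤ Real.sqrt (5 / 27)) (t : ℝ) :
    HasDerivAt (boundH β) (-(454 * β / 45) * boundH β t + 10 * boundH β t ^ 2) t := by
  have hd : 2 * Real.exp (454 * β / 45 * t) + 225 ≠ 0 := by positivity
  have := ((((hasDerivAt_exp_mul (454 * β / 45) t).const_mul 2).add_const 225).fun_inv hd).const_mul
    (227 * β)
  rw [funext (boundH_of_le h)]
  simp only [← div_eq_mul_inv] at this
  refine this.congr_deriv ?_
  simp only
  generalize Real.exp (454 * β / 45 * t) = e at *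
  field_simp
  ring

theorem hasDerivAt_boundH_of_lt {β t : ℝ} (h : Real.sqrt (5 / 27) < β)
    (ht : t ≤ 0) :
    HasDerivAt (boundH β) (-4 * boundH β t + 10 * boundH β t ^ 2) t := by
  have hd : 5 * β - (5 * β - 2) * Real.exp (4 * t) ≠ 0 := by
    linarith [boundH_large_denom (two_fifths_lt h) ht]
  have := ((((hasDerivAt_exp_mul 4 t).const_mul (5 * β - 2)).const_sub (5 * β)).fun_inv
    hd).const_mul (2 * β)
  rw [funext (boundH_of_lt h)]
  simp only [← div_eq_mul_inv] at this
  refine this.congr_deriv ?_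
  simp only
  generalize Real.exp (4 * t) = e at *
  obtain ⟨D, hD⟩ : ∃ D, D = 5 * β - (5 * β - 2) * e := ⟨_, rfl⟩
  rw [← hD] at hd ⊢
  field_simp
  rw [hD]
  ring

theorem lt_boundH_of_le {β t : ℝ} (h0 : 0 < β) (h : β ≤ Real.sqrt (5 / 27)) (ht : t < 0) :
    β < boundH β t := by
  have := exp_mul_lt_one (c := 454 * β / 45) (by positivity) ht
  rw [boundH_of_le h, lt_div_iff₀ (by positivity)]
  nlinarith

theorem boundH_le_of_le {β : ℝ} (h0 : 0 < β) (h : β ≤ Real.sqrt (5 / 27)) (t : ℝ) :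
    boundH β t ≤ 227 / 225 * β := by
  have := Real.exp_pos (454 * β / 45 * t)
  rw [boundH_of_le h, div_le_iff₀ (by positivity)]
  nlinarith

theorem lt_boundH_of_lt {β t : ℝ} (h : Real.sqrt (5 / 27) < β) (ht : t ≤ 0) :
    2 / 5 < boundH β t := by
  have hβ := two_fifths_lt h
  have := boundH_large_denom hβ ht
  rw [boundH_of_lt h, lt_div_iff₀ (by linarith)]
  nlinarith [Real.exp_pos (4 * t)]

theorem boundH_le_of_lt {β t : ℝ} (h : Real.sqrt (5 / 27) < β) (ht : t ≤ 0) :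
    boundH β t ≤ β := by
  have hβ := two_fifths_lt h
  have := boundH_large_denom hβ ht
  rw [boundH_of_lt h, div_le_iff₀ (by linarith)]
  nlinarith

namespace IsFlow

variable {β : ℝ} {H q : ℝ → ℝ}

theorem H_sq_lt_past (hf : IsFlow β H H q) (h0 : 0 < β) (hβ : β ^ 2 < 1 / 3) {t : ℝ}
    (ht : t < 0) : H t ^ 2 < 1 / 2 := by
  have h1 := hf.H_lt_past h0 hβ ht
  have h2 := hubbleCeil_sq_lt h0 hβ ht.le
  nlinarith [hf.H_pos t]

/-- At a contact, `speedH < L²(24/5 L² - 1) ≤ -cL + 10L²`. Hence `H - L` decreases through zero and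
is positive in the past. -/
theorem lt_H_of_logistic (hf : IsFlow β H H q) {L : ℝ → ℝ} {c : ℝ}
    (hL : ∀ t, t ≤ 0 → HasDerivAt L (-c * L t + 10 * L t ^ 2) t) (hL0 : L 0 = β)
    (hLpos : ∀ t, t ≤ 0 → 0 < L t) (hLle : ∀ t, t ≤ 0 → L t ^ 2 ≤ 5 / 6)
    (hLc : ∀ t, t ≤ 0 → L t * (24 / 5 * L t ^ 2 - 1) ≤ 10 * L t - c) {t : ℝ} (ht : t < 0) :
    L t < H t := by
  have := pos_of_deriv_neg_of_zero (f := fun t => H t - L t)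
    (fun t ht => (hf.hasDerivAt_H t).fun_sub (hL t ht)) (by simp [hf.H_init, hL0])
    (fun t ht h1 => by
      have e : H t = L t := sub_eq_zero.1 h1
      rw [e]
      have h2 := speedH_lt_of_one_le (hLpos t ht) (hf.one_le_q ht) (hLle t ht)
      have h3 := mul_le_mul_of_nonneg_left (hLc t ht) (hLpos t ht).le
      nlinarith) ht
  linarith

theorem boundH_lt (hf : IsFlow β H H q) (h0 : 0 < β) (hβ : β ^ 2 < 1 / 3) {t : ℝ}
    (ht : t < 0) : boundH β t < H t := by
  rcases le_or_gt β (Real.sqrt (5 / 27)) with h | h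
  · have h2 := sq_le_of_le_sqrt h h0
    have hlow : ∀ t, t ≤ 0 → β ≤ boundH β t := by
      intro t ht
      rcases ht.lt_or_eq with ht | rfl
      · exact (lt_boundH_of_le h0 h ht).le
      · exact (boundH_zero h0).ge
    -- The equilibrium `c/10 = 227β/225` confines the barrier to `[β, 227β/225]`.
    refine hf.lt_H_of_logistic (c := 454 * β / 45)
      (fun t _ => hasDerivAt_boundH_of_le h0 h t) (boundH_zero h0)
      (fun t ht => h0.trans_le (hlow t ht)) (fun t ht => ?_) (fun t ht => ?_) ht
    · have := boundH_le_of_le h0 h t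
      have := hlow t ht
      nlinarith
    · obtain ⟨u, hu⟩ : ∃ u, boundH β t = u * β := ⟨boundH β t / β, by field_simp⟩
      have h3 := boundH_le_of_le h0 h t
      have h4 := hlow t ht
      rw [hu] at h3 h4 ⊢
      have hu1 : 1 ≤ u := by nlinarith
      have hu2 : u ≤ 227 / 225 := le_of_mul_le_mul_right h3 h0
      -- After scaling by `β`, the threshold `5/27` removes `β`, leaving a cubic inequality in `u`
      -- on `[1, 227/225]`.
      have h5 : u ^ 2 * β ^ 2 ≤ u ^ 2 * (5 / 27) := by gcongr
      have h6 : u * (24 / 5 * (u ^ 2 * (5 / 27)) - 1) ≤ 10 * u - 454 / 45 := by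
        nlinarith [mul_nonneg (sub_nonneg.2 hu1) (sub_nonneg.2 hu2),
          mul_nonneg (mul_nonneg (sub_nonneg.2 hu1) (sub_nonneg.2 hu2)) (by linarith : 0 ≤ u)]
      have h7 : u * (24 / 5 * (u ^ 2 * β ^ 2) - 1) ≤ 10 * u - 454 / 45 := by
        refine le_trans ?_ h6
        gcongr
      have h8 := mul_le_mul_of_nonneg_right h7 h0.le
      nlinarith
  -- Here the equilibrium is `c/10 = 2/5`; the barrier stays between it and `β < 3/5`.
  · refine hf.lt_H_of_logistic (c := 4)
      (fun t ht => hasDerivAt_boundH_of_lt h ht) (boundH_zero h0)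
      (fun t ht => lt_trans (by norm_num) (lt_boundH_of_lt h ht))
      (fun t ht => ?_) (fun t ht => ?_) ht
    · have := boundH_le_of_lt h ht
      have := lt_boundH_of_lt h ht
      nlinarith
    · have h1 := boundH_le_of_lt h ht
      have h2 := lt_boundH_of_lt h ht
      have h3 : boundH β t < 3 / 5 := by nlinarith
      generalize boundH β t = u at *
      nlinarith [mul_pos (sub_pos.2 h2) (sub_pos.2 h3),
        mul_pos (mul_pos (sub_pos.2 h2) (sub_pos.2 h3)) (by linarith : 0 < u)]

theorem hasDerivAt_log_scalarDeriv (hf : IsFlow β H H q) (t : ℝ) :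
    HasDerivAt (fun t => Real.log (flowScalarDeriv H q t)) (scalarRate (H t) (q t)) t := by
  refine ((hf.hasDerivAt_scalarDeriv t).log (hf.scalarDeriv_pos t).ne').congr_deriv ?_
  rw [mul_div_cancel_left₀ _ (hf.scalarDeriv_pos t).ne']

theorem scalarDeriv_lt_past (hf : IsFlow β H H q) (h0 : 0 < β) (hβ : β ^ 2 < 1 / 3) {t : ℝ}
    (ht : t < 0) : flowScalarDeriv H q t < Real.sqrt 3 * Real.exp (-12 * t) := by
  have key := lt_of_deriv_pos_left (f := fun t => Real.log (flowScalarDeriv H q t) + 12 * t)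
    (fun t _ => (hf.hasDerivAt_log_scalarDeriv t).fun_add ((hasDerivAt_id t).const_mul 12))
    (fun t ht => by
      linarith [scalarRate_gt (hf.H_pos t) (hf.H_lt_one h0 hβ t) (hf.one_le_q ht.le)]) ht
  simp only [hf.scalarDeriv_zero] at key
  have h3 : 0 < Real.sqrt 3 := by positivity
  rw [Real.log_mul h3.ne' h0.ne'] at key
  rw [← Real.log_lt_log_iff (hf.scalarDeriv_pos t) (by positivity),
    Real.log_mul h3.ne' (Real.exp_pos _).ne', Real.log_exp]
  -- The factor `β < 1` of `φ̇(0) = √3 β` is discarded.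
  have : Real.log β < 0 := Real.log_neg h0 (by nlinarith)
  linarith

/-- An upper bound for the logarithmic derivative of `φ̇` in the past bounds `φ̇` from below. -/
theorem lt_scalarDeriv_of_rate (hf : IsFlow β H H q) {c C : ℝ} (hC : 0 < C)
    (hCβ : C ≤ Real.sqrt 3 * β) (hc : ∀ t < 0, scalarRate (H t) (q t) < c) {t : ℝ} (ht : t < 0) :
    C * Real.exp (c * t) < flowScalarDeriv H q t := by
  have key := lt_of_deriv_pos_left (f := fun t => c * t - Real.log (flowScalarDeriv H q t))
    (fun t _ => ((hasDerivAt_id t).const_mul c).fun_sub (hf.hasDerivAt_log_scalarDeriv t))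
    (fun t ht => by linarith [hc t ht]) ht
  simp only [hf.scalarDeriv_zero] at key
  have h1 := Real.log_le_log hC hCβ
  rw [← Real.log_lt_log_iff (by positivity) (hf.scalarDeriv_pos t),
    Real.log_mul hC.ne' (Real.exp_pos _).ne', Real.log_exp]
  linarith

theorem boundPhiDot_lt (hf : IsFlow β H H q) (h0 : 0 < β) (hβ : β ^ 2 < 1 / 3) {t : ℝ}
    (ht : t < 0) : boundPhiDot β t < flowScalarDeriv H q t := by
  have hrate : ∀ t < 0, scalarRate (H t) (q t) < -(9 / 5 * H t) := fun t ht =>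
    scalarRate_lt (hf.H_pos t) (hf.H_sq_lt_past h0 hβ ht) (hf.one_le_q ht.le)
  have h3 : 0 < Real.sqrt 3 := by positivity
  rcases le_or_gt β (Real.sqrt (5 / 27)) with h | h
  · rw [boundPhiDot, if_pos h]
    refine hf.lt_scalarDeriv_of_rate (by positivity) le_rfl (fun t ht => ?_) ht
    have h2 := sq_le_of_le_sqrt h h0
    have h4 := hf.boundH_lt h0 hβ ht
    have h5 := lt_boundH_of_le h0 h ht
    -- With `H > β` this leaves room, since `10/9 < 9/5`. In the other case `H > 2/5` gives
    -- `(9/5)(2/5) = 18/25 > 48/125`.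
    have h6 : 6 * β ^ 3 ≤ 10 / 9 * β := by nlinarith
    linarith [hrate t ht]
  · rw [boundPhiDot, if_neg h.not_ge]
    refine hf.lt_scalarDeriv_of_rate (by positivity) ?_ (fun t ht => ?_) ht
    · nlinarith [two_fifths_lt h]
    · have h4 := hf.boundH_lt h0 hβ ht
      have h5 := lt_boundH_of_lt h ht.le
      linarith [hrate t ht]

theorem lt_scalar_past (hf : IsFlow β H H q) (h0 : 0 < β) (hβ : β ^ 2 < 1 / 3) {t : ℝ}
    (ht : t < 0) : Real.sqrt 3 / 12 * (1 - Real.exp (-12 * t)) < flowScalar H q t := by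
  have := lt_of_deriv_pos_left
    (f := fun t => Real.sqrt 3 / 12 * (1 - Real.exp (-12 * t)) - flowScalar H q t)
    (fun t _ => (((hasDerivAt_exp_mul (-12) t).const_sub 1).const_mul
      (Real.sqrt 3 / 12)).fun_sub (hf.hasDerivAt_scalar t))
    (fun t ht => by linarith [hf.scalarDeriv_lt_past h0 hβ ht]) ht
  simp only [hf.scalar_zero, mul_zero, Real.exp_zero, sub_self] at this
  linarith

theorem hasDerivAt_boundPhi {β : ℝ} (h0 : 0 < β) (t : ℝ) :
    HasDerivAt (boundPhi β) (boundPhiDot β t) t := by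
  unfold boundPhi boundPhiDot
  split_ifs
  · refine (((hasDerivAt_exp_mul (-6 * β ^ 3) t).const_sub 1).const_mul
      (Real.sqrt 3 / (6 * β ^ 2))).congr_deriv ?_
    field_simp
  · refine (((hasDerivAt_exp_mul (-(48 / 125)) t).const_sub 1).const_mul
      (25 * Real.sqrt 3 / 24)).congr_deriv ?_
    ring

theorem scalar_lt_past (hf : IsFlow β H H q) (h0 : 0 < β) (hβ : β ^ 2 < 1 / 3) {t : ℝ}
    (ht : t < 0) : flowScalar H q t < boundPhi β t := by
  have := lt_of_deriv_pos_left (f := fun t => flowScalar H q t - boundPhi β t)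
    (fun t _ => (hf.hasDerivAt_scalar t).fun_sub (hasDerivAt_boundPhi h0 t))
    (fun t ht => by linarith [hf.boundPhiDot_lt h0 hβ ht]) ht
  have h1 : boundPhi β 0 = 0 := by simp [boundPhi]
  simp only [hf.scalar_zero, h1] at this
  linarith

end IsFlow

/-! ### Scale factor in the past and assembly of the past bounds. -/

theorem boundScale_pos {β t : ℝ} (ht : t ≤ 0) :
    0 < boundScale β t := by
  rcases le_or_gt β (Real.sqrt (5 / 27)) with h | h
  · rw [boundScale, if_pos h]
    positivity
  · rw [boundScale, if_neg h.not_ge]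
    have := two_fifths_lt h
    have h1 : 1 ≤ Real.exp (-4 * t) := Real.one_le_exp (by linarith)
    have : 0 < 5 * β * Real.exp (-4 * t) - (5 * β - 2) := by nlinarith
    positivity

/-- The bound for `a / a₀` is the exponential of the integral of `boundH`; the exponent `1/10` comes
from the coefficient `10` of the logistic equation. -/
theorem hasDerivAt_log_boundScale {β t : ℝ} (h0 : 0 < β) (ht : t ≤ 0) :
    HasDerivAt (fun t => Real.log (boundScale β t)) (boundH β t) t := by
  rcases le_or_gt β (Real.sqrt (5 / 27)) with h | h
  · have e : (fun t => Real.log (boundScale β t)) = fun t =>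
        1 / 10 * (Real.log 227 - Real.log (225 * Real.exp (-(454 * β / 45) * t) + 2)) := by
      ext s
      rw [boundScale, if_pos h, Real.log_rpow (by positivity),
        Real.log_div (by norm_num) (by positivity),
        show -(454 * β * s / 45) = -(454 * β / 45) * s by ring]
    rw [e]
    have hd : 225 * Real.exp (-(454 * β / 45) * t) + 2 ≠ 0 := by positivity
    refine ((((((hasDerivAt_exp_mul (-(454 * β / 45)) t).const_mul 225).add_const 2).log
      hd).const_sub _).const_mul (1 / 10)).congr_deriv ?_
    rw [boundH_of_le h]
    have he : Real.exp (-(454 * β / 45) * t) = (Real.exp (454 * β / 45 * t))⁻¹ := by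
      rw [← Real.exp_neg]; ring_nf
    rw [he]
    have := Real.exp_pos (454 * β / 45 * t)
    generalize Real.exp (454 * β / 45 * t) = x at *
    have h1 : 225 + 2 * x ≠ 0 := by positivity
    have h2 : 2 * x + 225 ≠ 0 := by positivity
    field_simp
    rw [add_comm (x * 2) 225]
    field_simp
    norm_num
  · have hβ := two_fifths_lt h
    have hD : 0 < 5 * β * Real.exp (-4 * t) - (5 * β - 2) := by
      have : 1 ≤ Real.exp (-4 * t) := Real.one_le_exp (by linarith)
      nlinarith
    -- The identity is only local: for large positive times the denominator is negative.
    have hev : (fun t => Real.log (boundScale β t)) =ᶠ[nhds t] fun t =>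
        1 / 10 * (Real.log 2 - Real.log (5 * β * Real.exp (-4 * t) - (5 * β - 2))) := by
      have hc : Continuous fun s : ℝ => 5 * β * Real.exp (-4 * s) - (5 * β - 2) := by fun_prop
      filter_upwards [hc.continuousAt.eventually (lt_mem_nhds hD)] with s hs
      rw [boundScale, if_neg h.not_ge, Real.log_rpow (by positivity),
        Real.log_div (by norm_num) hs.ne']
    refine HasDerivAt.congr_of_eventuallyEq ?_ hev
    refine ((((((hasDerivAt_exp_mul (-4) t).const_mul (5 * β)).sub_const (5 * β - 2)).log
      hD.ne').const_sub _).const_mul (1 / 10)).congr_deriv ?_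
    have hd : 5 * β - (5 * β - 2) * Real.exp (4 * t) ≠ 0 := by
      linarith [boundH_large_denom hβ ht]
    have he : Real.exp (-4 * t) * Real.exp (4 * t) = 1 := by
      rw [← Real.exp_add]; ring_nf; exact Real.exp_zero
    have hv : 1 / 10 * -(5 * β * (-4 * Real.exp (-4 * t))
        / (5 * β * Real.exp (-4 * t) - (5 * β - 2)))
        = 2 * β * Real.exp (-4 * t) / (5 * β * Real.exp (-4 * t) - (5 * β - 2)) := by ring
    rw [boundH_of_lt h, hv, div_eq_div_iff hD.ne' hd]
    linear_combination (-2 * β * (5 * β - 2)) * he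

/-- The logarithm of the lower bound for the scale factor has derivative `hubbleCeil`. -/
theorem hasDerivAt_log_scaleFloor {β t : ℝ} (h0 : 0 < β) (hβ : β ^ 2 < 1 / 3) :
    HasDerivAt (fun t => 1 / 3 * (Real.log 2 - Real.log ((Real.sqrt 2 * β + 1)
      + (1 - Real.sqrt 2 * β) * Real.exp (3 * Real.sqrt 2 * t))) + Real.sqrt 2 / 2 * t)
      (hubbleCeil β t) t := by
  have hs := Real.mul_self_sqrt (show (0 : ℝ) ≤ 2 by norm_num)
  have h2 : 0 < Real.sqrt 2 := by positivity
  have hden := hubbleCeil_denom_pos h0 hβ t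
  have e : Real.sqrt 2 * ((Real.sqrt 2 * β + 1)
      + (1 - Real.sqrt 2 * β) * Real.exp (3 * Real.sqrt 2 * t))
      = 2 * β + Real.sqrt 2 + (Real.sqrt 2 - 2 * β) * Real.exp (3 * Real.sqrt 2 * t) := by
    linear_combination (β - β * Real.exp (3 * Real.sqrt 2 * t)) * hs
  have hD : 0 < (Real.sqrt 2 * β + 1)
      + (1 - Real.sqrt 2 * β) * Real.exp (3 * Real.sqrt 2 * t) := by
    rw [← e] at hden
    exact pos_of_mul_pos_right hden h2.le
  refine (((((((hasDerivAt_exp_mul (3 * Real.sqrt 2) t).const_mul (1 - Real.sqrt 2 * β)).const_add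
    (Real.sqrt 2 * β + 1)).log hD.ne').const_sub _).const_mul (1 / 3)).fun_add
    ((hasDerivAt_id t).const_mul (Real.sqrt 2 / 2))).congr_deriv ?_
  rw [hubbleCeil, ← e]
  generalize Real.exp (3 * Real.sqrt 2 * t) = x at *
  generalize Real.sqrt 2 = s at *
  obtain ⟨D, hDd⟩ : ∃ D, D = s * β + 1 + (1 - s * β) * x := ⟨_, rfl⟩
  rw [← hDd] at hD ⊢
  field_simp
  rw [hDd]
  have hs2 : s ^ 2 = 2 := by rw [sq, hs]
  have hs4 : s ^ 4 = 4 := by rw [show s ^ 4 = (s ^ 2) ^ 2 by ring, hs2]; norm_num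
  have hs3 : s ^ 3 = 2 * s := by rw [pow_succ, hs2]
  ring_nf
  rw [hs4, hs3]
  ring

theorem IsGlobalSolution.pastBounds {a₀ β : ℝ} {a φ : ℝ → ℝ} (h : IsGlobalSolution a₀ β a φ)
    (ha₀ : 0 < a₀) (h0 : 0 < β) (hβ : β ^ 2 < 1 / 3) {t : ℝ} (ht : t < 0) :
    PastBounds a₀ β a φ t := by
  obtain ⟨q, hf, e1, e2⟩ := h.exists_isFlow h0
  have hat := h.isFLRW.scale_pos t
  have hlog := fun t => hasDerivAt_log_scale h.isFLRW t
  refine ⟨?_, ?_, hf.boundH_lt h0 hβ ht, hf.H_lt_past h0 hβ ht,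
    fun hle => lt_boundH_of_le h0 hle ht, fun hlt => lt_boundH_of_lt hlt ht.le, ?_, ?_, ?_, ?_⟩
  · rw [e1]; exact hf.lt_scalar_past h0 hβ ht
  · rw [e1]; exact hf.scalar_lt_past h0 hβ ht
  · rw [e2]; exact hf.boundPhiDot_lt h0 hβ ht
  · rw [e2]; exact hf.scalarDeriv_lt_past h0 hβ ht
  · have hb : Real.sqrt 2 * β < 1 := by
      have h1 := sqrt_two_sub_pos hβ
      have h2 : 0 < Real.sqrt 2 := by positivity
      have := Real.mul_self_sqrt (show (0 : ℝ) ≤ 2 by norm_num)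
      nlinarith
    have hD : 0 < (Real.sqrt 2 * β + 1)
        + (1 - Real.sqrt 2 * β) * Real.exp (3 * Real.sqrt 2 * t) := by
      have := sub_pos.2 hb
      positivity
    have := lt_of_deriv_pos_left
      (fun t _ => (hasDerivAt_log_scaleFloor h0 hβ).fun_sub (hlog t))
      (fun t ht => by linarith [hf.H_lt_past h0 hβ ht]) ht
    simp only [h.scale_init, mul_zero, Real.exp_zero] at this
    rw [show Real.sqrt 2 * β + 1 + (1 - Real.sqrt 2 * β) * 1 = 2 by ring] at this
    rw [← Real.log_lt_log_iff (by positivity) hat, Real.log_mul (by positivity) (by positivity),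
      Real.log_mul ha₀.ne' (by positivity), Real.log_rpow (by positivity),
      Real.log_div (by norm_num) hD.ne', Real.log_exp]
    linarith
  · have := lt_of_deriv_pos_left (f := fun t => Real.log (a t) - Real.log (boundScale β t))
      (fun t ht => (hlog t).fun_sub (hasDerivAt_log_boundScale h0 ht))
      (fun t ht => by linarith [hf.boundH_lt h0 hβ ht]) ht
    have h1 : boundScale β 0 = 1 := by
      unfold boundScale
      split_ifs <;> norm_num
    simp only [h.scale_init, h1, Real.log_one] at this
    have hB := boundScale_pos (β := β) ht.le
    rw [← Real.log_lt_log_iff hat (by positivity), Real.log_mul ha₀.ne' hB.ne']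
    linarith

end ESGB

theorem theorem1p1 :
    (∀ a φ : ℝ → ℝ, ESGB.IsFLRW a φ →
      (ESGB.FieldEquations (ESGB.flrw a) (fun x => φ (x 0)) ↔ ESGB.ReducedSystem a φ)) ∧
    ∀ a₀ β : ℝ, 0 < a₀ → 0 < β → β < Real.sqrt 3 / 3 →
      (∃! p : (ℝ → ℝ) × (ℝ → ℝ), ESGB.IsGlobalSolution a₀ β p.1 p.2) ∧
      ∀ a φ : ℝ → ℝ, ESGB.IsGlobalSolution a₀ β a φ →
        (∀ t < 0, ESGB.PastBounds a₀ β a φ t) ∧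
        (∀ t > 0, ESGB.FutureBounds a₀ β a φ t) := by
  refine ⟨fun a φ h => ESGB.fieldEquations_iff_reducedSystem h, fun a₀ β ha₀ h0 hβ => ?_⟩
  have hβ' : β ^ 2 < 1 / 3 := by
    have h3 := Real.mul_self_sqrt (show (0 : ℝ) ≤ 3 by norm_num)
    nlinarith
  exact ⟨ESGB.existsUnique_isGlobalSolution ha₀ h0 hβ', fun a φ h =>
    ⟨fun t ht => h.pastBounds ha₀ h0 hβ' ht, fun t ht => h.futureBounds ha₀ h0 hβ' ht⟩⟩
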